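/- **Theorem 2 (Achievability).** Let $P>0$ and $N>0$. Logarithms to base 2 are written $\log_2$. *Optimization.* For an integer $n\ge 1$ let $$C_n=\sup_{\mathbf P}\ \inf_{(\mathbf N,m)}\ \frac1{2n}\sum_{t=1}^{m}\log_2\frac{P_t}{N_t},$$ where the supremum is over all $\mathbf P=(P_1,\dots,P_n)$ with $P_t>0$ for all $t$ and $\sum_{t=1}^nP_t=nP$, and, for given $\mathbf P$, the infimum is over all integers $1\le m\le n$ and all $\mathbf N=(N_1,\dots,N_n)$ with $N_t>0$ for all $t$, $\sum_{t=1}^nN_t\le nN$, $N_t\le P_t$ for $t\le m$, and $$nP-\sum_{t=1}^mP_t\ \le\ 2nN-\sum_{t=1}^m2N_t .$$ *Channel.* A stochastic code with message set $\mathcal W$, block-length $n$ and signal power $P$ consists of, for each $w\in\mathcal W$, a probability distribution of the transmitted sequence $\mathbf X\in\mathbb R^n$ given $W=w$, supported on $\{\|\mathbf x\|^2\le nP\}$, and of a (possibly randomized) decoder, that is a conditional distribution of the estimate $V\in\mathcal W$ given the received sequence $\mathbf Y\in\mathbb R^n$. A causal adversary is a conditional distribution of the noise $\mathbf S\in\mathbb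 R^n$ given $\mathbf X$, supported on $\{\|\mathbf s\|^2\le nN\}$, such that for every $t$ the conditional distribution of $S_t$ given $(S_1,\dots,S_{t-1})$ and $\mathbf X$ depends only on $(S_1,\dots,S_{t-1})$ and $(X_1,\dots,X_t)$. The receiver gets $\mathbf Y=\mathbf X+\mathbf S$. The maximal probability of error $\mathbb P_{\max}$ of a code is the supremum of $\Pr(V\ne w\mid W=w)$ over all messages $w\in\mathcal W$ and all causal adversaries (which may be chosen depending on $w$). *Claim.* There is a constant $c_1>0$ (depending only on $P,N$) such that for every $\varepsilon>0$ there are a constant $c_2>0$ (depending only on $P,N,\varepsilon$) and an $n_0$ such that for every $n\ge n_0$ there is a stochastic code of block-length $n$ and signal power $P$ with rate $R=C_{\lfloor\sqrt n\rfloor}-\varepsilon$, that is with $|\mathcal W|=\lceil 2^{nR}\rceil$ messages, whose maximal probability of error satisfies $$\mathbb P_{\max}\ \le\ \exp\!\Big(-c_1\Big((n+\ln\varepsilon)\,e^{\sqrt n}-\frac n\varepsilon\Big)\Big)+\exp(-c_2\,n).$$ -/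

import Mathlib

open MeasureTheory ProbabilityTheory
open scoped ENNReal

namespace CausalQuadratic

/-! ### The reference optimization and its optimal value `C_n` -/

/-- Power allocations of the transmitter: positive sequences `P_1, …, P_n` that use up the
energy budget `n P`. -/
def signalPowerSet (n : ℕ) (P : ℝ) : Set (Fin n → ℝ) :=
  {p | (∀ t, 0 < p t) ∧ ∑ t, p t = n * P}

/-- Power allocations of the adversary: positive sequences `N_1, …, N_n` of total energy at
most `n N`. -/
def noisePowerSet (n : ℕ) (N : ℝ) : Set (Fin n → ℝ) :=
  {q | (∀ t, 0 < q t) ∧ ∑ t, q t ≤ n * N}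

/-- For a given transmitter allocation `p`, the pairs of an adversary allocation and a division
point that satisfy the constraints. A division point `m : Fin n` is the last index of the prefix,
so the prefix is never empty and may be the whole block. -/
def feasibleAttacks (n : ℕ) (P N : ℝ) (p : Fin n → ℝ) : Set ((Fin n → ℝ) × Fin n) :=
  {a | a.1 ∈ noisePowerSet n N ∧
    (∀ t ≤ a.2, a.1 t ≤ p t) ∧
    n * P - ∑ t ∈ Finset.Iic a.2, p t ≤ 2 * (n * N) - ∑ t ∈ Finset.Iic a.2, 2 * a.1 t}

/-- The objective function `(1 / 2n) ∑_{t ≤ m} log₂ (P_t / N_t)`. -/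
noncomputable def objective (n : ℕ) (p : Fin n → ℝ) (a : (Fin n → ℝ) × Fin n) : ℝ :=
  1 / (2 * n) * ∑ t ∈ Finset.Iic a.2, Real.logb 2 (p t / a.1 t)

/-- The optimal value `C_n` of the scaled babble-and-push optimization. For `n ≥ 1` and
`P, N > 0` the supremum and all the infima are over nonempty bounded sets of reals. -/
noncomputable def optimalValue (n : ℕ) (P N : ℝ) : ℝ :=
  ⨆ p : signalPowerSet n P, ⨅ a : feasibleAttacks n P N p, objective n p a

/-! ### Codes -/

/-- Real sequences of length `n` of energy at most `n E`. -/
def energyBall (n : ℕ) (E : ℝ) : Set (Fin n → ℝ) :=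
  {x | ∑ t, x t ^ 2 ≤ n * E}

/-- A stochastic code with `M` messages, block-length `n` and signal power `P`: for each message,
a law of the transmitted sequence on the ball of energy `n P`, and a (possibly randomized)
decoder. -/
structure StochasticCode (M n : ℕ) (P : ℝ) where
  /-- the law of the transmitted sequence, given the message -/
  encoder : Fin M → Measure (Fin n → ℝ)
  encoder_prob : ∀ w, IsProbabilityMeasure (encoder w)
  encoder_power : ∀ w, ∀ᵐ x ∂(encoder w), x ∈ energyBall n P
  /-- the law of the estimated message, given the received sequence -/
  decoder : Kernel (Fin n → ℝ) (Fin M)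
  decoder_markov : IsMarkovKernel decoder

/-! ### Causal adversaries -/

/-- The coordinates of `x` up to and including time `t`. -/
def upTo {n : ℕ} (t : Fin n) (x : Fin n → ℝ) : Set.Iic t → ℝ := fun i => x i

/-- The coordinates of `s` strictly before time `t`. -/
def before {n : ℕ} (t : Fin n) (s : Fin n → ℝ) : Set.Iio t → ℝ := fun i => s i

/-- The law `noise` of the noise sequence given the transmitted sequence has the causality
property: at each time `t`, the conditional law of `S_t` given the past noise and the whole
transmitted sequence `x` depends on the past noise and on `x_1, …, x_t` only. -/
def IsCausal {n : ℕ} (P : ℝ) (noise : Kernel (Fin n → ℝ) (Fin n → ℝ)) : Prop :=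
  ∀ t : Fin n, ∃ κ : Kernel ((Set.Iic t → ℝ) × (Set.Iio t → ℝ)) ℝ, IsMarkovKernel κ ∧
    ∀ x ∈ energyBall n P,
      (noise x).map (fun s => (before t s, s t)) =
        ((noise x).map (before t)) ⊗ₘ (κ.sectR (upTo t x))

/-- A causal adversary with noise power `N`, on a channel with signal power `P`. -/
structure CausalAdversary (n : ℕ) (P N : ℝ) where
  /-- the law of the noise sequence, given the transmitted sequence -/
  noise : Kernel (Fin n → ℝ) (Fin n → ℝ)
  noise_markov : IsMarkovKernel noise
  noise_power : ∀ x ∈ energyBall n P, ∀ᵐ s ∂(noise x), s ∈ energyBall n N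
  causal : IsCausal P noise

/-! ### Probability of error -/

/-- The probability that the estimated message differs from `w`, given that `w` was selected,
when the received sequence is the transmitted sequence plus the noise of the adversary. -/
noncomputable def errorProb {M n : ℕ} {P N : ℝ} (c : StochasticCode M n P)
    (A : CausalAdversary n P N) (w : Fin M) : ℝ≥0∞ :=
  ∫⁻ x, ∫⁻ s, c.decoder (x + s) {w}ᶜ ∂(A.noise x) ∂(c.encoder w)

/-- The maximal probability of error: the worst case over the message and over all causal
adversaries of noise power `N`, whose strategy may depend on the message. -/
noncomputable def maxErrorProb {M n : ℕ} {P : ℝ} (N : ℝ) (c : StochasticCode M n P) : ℝ≥0∞ :=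
  ⨆ w : Fin M, ⨆ A : CausalAdversary n P N, errorProb c A w

end CausalQuadratic

/-! The code cuts the block into a fixed number `I = K * J` of blocks of length `l = n / I`. In each
block the transmitter draws a fresh uniform key out of exponentially many and sends the codeword of
its message and key, scaled according to an allocation of `K` powers that is nearly optimal for
`C_K`. Here `K` depends on `ε` only: averaging over groups gives `C_m ≤ (1 + K² / m) C_K`
(`optimalValue_le_mul`), so `C_K` may replace the optimal value at the growing length.

A random codebook has two properties (`exists_codebook`). For two messages and a block, all but
boundedly many keys of the first give a codeword nearly orthogonal to every codeword of the second.
And for every received sequence and every prefix, only boundedly many messages have codewords so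
close to the prefix that it carries more information than the message. Both follow from union
bounds: a violation needs many independent events of exponentially small probability, and a large
constant number of them beats the exponentially many choices.

The decoder picks, among the hypotheses compatible with the noise budget, one whose prefix becomes
list decodable earliest, at block `i` say. Before `i`, neither this hypothesis nor the true one
carries enough information. The definition of `C_K` then implies that under both hypotheses the
energy left to the noise is less than half the signal energy left (`notPushable_of_le_objective`).
If the two remaining codewords are nearly orthogonal, the parallelogram law shows that no received
sequence is that close to both, so a wrong hypothesis is impossible (`decode_eq`).

An error thus needs a bad key in some block `j ≥ i` with respect to one of the boundedly many
messages listed after `i` blocks. By causality that list is independent of the key of block `j`, so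
the probability is at most a constant over the number of keys (`mul_sum_badEvent_le`). This is
exponentially small in `n`, and the second term of the claimed bound suffices. -/

namespace CausalQuadratic

/-! ### The uniform law on a thin spherical shell -/

/-- The closed unit ball without the concentric open ball of radius `1 - τ`. -/
def shell (E : Type*) [NormedAddCommGroup E] (τ : ℝ) : Set E :=
  Metric.closedBall 0 1 \ Metric.ball 0 (1 - τ)

lemma measurableSet_shell {E : Type*} [NormedAddCommGroup E] [MeasurableSpace E] [BorelSpace E]
    (τ : ℝ) : MeasurableSet (shell E τ) :=
  measurableSet_closedBall.diff measurableSet_ball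

section Shell

variable {E : Type*} [NormedAddCommGroup E] [InnerProductSpace ℝ E] [FiniteDimensional ℝ E]
  [MeasurableSpace E] [BorelSpace E]

/-- The uniform probability distribution on the shell. -/
noncomputable def shellMeasure (E : Type*) [NormedAddCommGroup E] [InnerProductSpace ℝ E]
    [FiniteDimensional ℝ E] [MeasurableSpace E] [BorelSpace E] (τ : ℝ) : Measure E :=
  ProbabilityTheory.cond volume (shell E τ)

/-- In high dimension the removed inner ball has a share `(1 - τ) ^ d` of the volume. Conditioning
on the shell therefore costs a factor of at most two, while it keeps the norms above `1 - τ`. -/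
lemma volume_closedBall_le_two_mul_shell {τ : ℝ} (h1 : τ < 1)
    (hd : (1 - τ) ^ Module.finrank ℝ E ≤ 1 / 2) :
    volume (Metric.closedBall (0 : E) 1) ≤ 2 * volume (shell E τ) := by
  have hball : volume (Metric.ball (0 : E) (1 - τ)) ≤
      ENNReal.ofReal (1 / 2) * volume (Metric.closedBall (0 : E) 1) := by
    rw [Measure.addHaar_ball_of_pos volume (0 : E) (by linarith : 0 < 1 - τ)]
    gcongr
    exact Metric.ball_subset_closedBall
  have hle : volume (Metric.closedBall (0 : E) 1) ≤
      volume (shell E τ) + volume (Metric.ball (0 : E) (1 - τ)) :=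
    (measure_mono (by intro x hx; simp only [shell, Set.mem_union, Set.mem_sdiff]; tauto)).trans
      (measure_union_le _ _)
  have hfin : volume (Metric.closedBall (0 : E) 1) ≠ ∞ := measure_closedBall_lt_top.ne
  have hfin' : volume (shell E τ) ≠ ∞ := measure_ne_top_of_subset Set.sdiff_subset hfin
  have h2 := hle.trans (add_le_add_right hball _)
  rw [← ENNReal.toReal_le_toReal hfin (by finiteness)] at h2 ⊢
  rw [ENNReal.toReal_add hfin' (by finiteness), ENNReal.toReal_mul,
    ENNReal.toReal_ofReal (by norm_num)] at h2
  rw [ENNReal.toReal_mul, ENNReal.toReal_ofNat]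
  linarith

lemma volume_shell_ne_zero {τ : ℝ} (h1 : τ < 1) (hd : (1 - τ) ^ Module.finrank ℝ E ≤ 1 / 2) :
    volume (shell E τ) ≠ 0 := by
  intro h
  have := volume_closedBall_le_two_mul_shell (E := E) h1 hd
  rw [h, mul_zero] at this
  exact (Metric.measure_closedBall_pos volume (0 : E) one_pos).not_ge this

lemma volume_shell_ne_top (τ : ℝ) : volume (shell E τ) ≠ ∞ :=
  measure_ne_top_of_subset Set.sdiff_subset measure_closedBall_lt_top.ne

lemma isProbabilityMeasure_shellMeasure {τ : ℝ} (h1 : τ < 1)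
    (hd : (1 - τ) ^ Module.finrank ℝ E ≤ 1 / 2) : IsProbabilityMeasure (shellMeasure E τ) :=
  ProbabilityTheory.cond_isProbabilityMeasure_of_finite (volume_shell_ne_zero h1 hd)
    (volume_shell_ne_top τ)

lemma shellMeasure_compl_shell (τ : ℝ) :
    shellMeasure E τ (shell E τ)ᶜ = 0 := by
  rw [shellMeasure, ProbabilityTheory.cond_apply (measurableSet_shell τ)]
  simp

/-- Working with a solid shell instead of the sphere turns probability estimates into ratios of ball
volumes. -/
lemma shellMeasure_le {τ : ℝ} (h1 : τ < 1) (hd : (1 - τ) ^ Module.finrank ℝ E ≤ 1 / 2)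
    {s : Set E} {c : E} {r : ℝ} (hr : 0 ≤ r)
    (hs : s ∩ Metric.closedBall 0 1 ⊆ Metric.closedBall c r) :
    shellMeasure E τ s ≤ ENNReal.ofReal (2 * r ^ Module.finrank ℝ E) := by
  rw [shellMeasure, ProbabilityTheory.cond_apply (measurableSet_shell τ), mul_comm,
    ← div_eq_mul_inv]
  refine ENNReal.div_le_of_le_mul ?_
  calc volume (shell E τ ∩ s) ≤ volume (Metric.closedBall c r) :=
        measure_mono fun x hx => hs ⟨hx.2, hx.1.1⟩
    _ = ENNReal.ofReal (r ^ Module.finrank ℝ E) * volume (Metric.closedBall (0 : E) 1) :=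
        Measure.addHaar_closedBall' volume c hr
    _ ≤ ENNReal.ofReal (r ^ Module.finrank ℝ E) * (2 * volume (shell E τ)) := by
        gcongr
        exact volume_closedBall_le_two_mul_shell h1 hd
    _ = _ := by
        rw [ENNReal.ofReal_mul (by norm_num), ENNReal.ofReal_ofNat]; ring

/-- The cap lies in the ball around `τ • u` of radius `√(1 - τ²)`, as expanding `‖z - τ • u‖²`
shows. -/
lemma shellMeasure_cap_le {τ : ℝ} (h0 : 0 < τ) (h1 : τ < 1)
    (hd : (1 - τ) ^ Module.finrank ℝ E ≤ 1 / 2) {u : E} (hu : ‖u‖ ≤ 1) :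
    shellMeasure E τ {z | τ < inner ℝ z u} ≤
      ENNReal.ofReal (2 * √(1 - τ ^ 2) ^ Module.finrank ℝ E) := by
  refine shellMeasure_le h1 hd (c := τ • u) (Real.sqrt_nonneg _) ?_
  rintro z ⟨hz, hz1⟩
  simp only [Set.mem_ofPred_eq, Metric.mem_closedBall, dist_eq_norm, sub_zero] at *
  refine Real.le_sqrt_of_sq_le ?_
  rw [norm_sub_sq_real, inner_smul_right, norm_smul, Real.norm_of_nonneg h0.le]
  have h2 : ‖z‖ ^ 2 ≤ 1 := pow_le_one₀ (norm_nonneg z) hz1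
  have h3 : (τ * ‖u‖) ^ 2 ≤ τ ^ 2 := by
    exact pow_le_pow_left₀ (by positivity) (mul_le_of_le_one_right h0.le hu) 2
  nlinarith

/-- Euclidean balls have finite nets of exponential size. -/
lemma exists_net {R γ : ℝ} (hR : 0 ≤ R) (hγ : 0 < γ) :
    ∃ t : Finset E, t.Nonempty ∧ (t.card : ℝ) ≤ (2 * R / γ + 1) ^ Module.finrank ℝ E ∧
      ∀ x : E, ‖x‖ ≤ R → ∃ y ∈ t, dist x y ≤ γ := by
  classical
  have hb : 0 ≤ 2 * R / γ := by positivity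
  have hcard : ∀ t : Finset E, (∀ x ∈ t, ‖x‖ ≤ R) → (∀ x ∈ t, ∀ y ∈ t, x ≠ y → γ < dist x y) →
      (t.card : ℝ) ≤ (2 * R / γ + 1) ^ Module.finrank ℝ E := by
    intro t ht hsep
    -- Packing bound: the disjoint balls of radius `γ / 2` all fit into the ball of radius `R + γ /
    -- 2`.
    have hdisj : (t : Set E).PairwiseDisjoint fun x => Metric.closedBall x (γ / 2) := by
      intro x hx y hy hxy
      refine Metric.closedBall_disjoint_closedBall ?_
      linarith [hsep x hx y hy hxy]
    have h1 : volume (⋃ x ∈ t, Metric.closedBall x (γ / 2)) =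
        ∑ x ∈ t, volume (Metric.closedBall x (γ / 2)) :=
      measure_biUnion_finset hdisj fun _ _ => measurableSet_closedBall
    have h2 : volume (⋃ x ∈ t, Metric.closedBall x (γ / 2)) ≤
        volume (Metric.closedBall (0 : E) (R + γ / 2)) := by
      refine measure_mono (Set.iUnion₂_subset fun x hx => ?_)
      refine Metric.closedBall_subset_closedBall' ?_
      rw [dist_zero_right]; linarith [ht x hx]
    have hv : volume (Metric.closedBall (0 : E) 1) ≠ ∞ := measure_closedBall_lt_top.ne
    have hv0 : volume (Metric.closedBall (0 : E) 1) ≠ 0 :=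
      (Metric.measure_closedBall_pos volume (0 : E) one_pos).ne'
    have hv' : 0 < (volume (Metric.closedBall (0 : E) 1)).toReal := ENNReal.toReal_pos hv0 hv
    rw [h1, Measure.addHaar_closedBall' volume (0 : E) (by positivity : 0 ≤ R + γ / 2)] at h2
    simp only [Measure.addHaar_closedBall' volume _ (by positivity : 0 ≤ γ / 2),
      Finset.sum_const, nsmul_eq_mul] at h2
    rw [← ENNReal.toReal_le_toReal (by finiteness) (by finiteness)] at h2
    simp only [ENNReal.toReal_mul, ENNReal.toReal_natCast] at h2
    rw [ENNReal.toReal_ofReal (by positivity), ENNReal.toReal_ofReal (by positivity),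
      ← mul_assoc] at h2
    have h3 := le_of_mul_le_mul_right h2 hv'
    rw [← le_div_iff₀ (by positivity), ← div_pow] at h3
    have h4 : (R + γ / 2) / (γ / 2) = 2 * R / γ + 1 := by field_simp
    rwa [h4] at h3
  -- A separated set of largest cardinality, which exists by the packing bound, is a net: a point
  -- far from all of it could be added.
  obtain ⟨m, hm⟩ := exists_nat_ge ((2 * R / γ + 1) ^ Module.finrank ℝ E)
  let p : ℕ → Prop := fun k => ∃ t : Finset E, t.card = k ∧ (∀ x ∈ t, ‖x‖ ≤ R) ∧
    ∀ x ∈ t, ∀ y ∈ t, x ≠ y → γ < dist x y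
  have hp1 : p 1 := ⟨{0}, by simp, by simpa using hR, by simp⟩
  have hm1 : 1 ≤ m := by
    have : (1 : ℝ) ≤ (2 * R / γ + 1) ^ Module.finrank ℝ E := one_le_pow₀ (by linarith)
    exact_mod_cast this.trans hm
  obtain ⟨t, htc, htR, hts⟩ := Nat.findGreatest_spec (P := p) hm1 hp1
  have hpos : 1 ≤ Nat.findGreatest p m := Nat.le_findGreatest hm1 hp1
  refine ⟨t, Finset.card_pos.1 (by omega), hcard t htR hts, ?_⟩
  intro x hx
  by_contra! hcon
  have hxt : x ∉ t := fun h => by simpa using (hcon x h).trans_le' hγ.le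
  have hnew : p (Nat.findGreatest p m + 1) := by
    refine ⟨insert x t, by rw [Finset.card_insert_of_notMem hxt, htc], ?_, ?_⟩
    · intro y hy
      rcases Finset.mem_insert.1 hy with rfl | h
      exacts [hx, htR y h]
    · intro y hy z hz hyz
      rcases Finset.mem_insert.1 hy with rfl | hy' <;> rcases Finset.mem_insert.1 hz with rfl | hz'
      · exact absurd rfl hyz
      · exact hcon z hz'
      · rw [dist_comm]; exact hcon y hy'
      · exact hts y hy' z hz' hyz
  obtain ⟨t', ht'c, ht'R, ht's⟩ := hnew
  have hle : Nat.findGreatest p m + 1 ≤ m := by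
    have := (hcard t' ht'R ht's).trans hm
    rw [ht'c] at this
    exact_mod_cast this
  have hp' : p (Nat.findGreatest p m + 1) := ⟨t', ht'c, ht'R, ht's⟩
  have := Nat.le_findGreatest hle hp'
  omega

end Shell

/-! ### Independent random codewords -/

section Random

/-- Given the coordinates outside the range of `a`, in particular all partners `x (b t)`, the
coordinates `x (a t)` are still independent, so Fubini gives a product. The partners may coincide;
only `a` needs to be injective. -/
lemma pi_setOf_forall_rel_le {ι κ E : Type*} [Fintype ι] [Fintype κ] [MeasurableSpace E]
    (μ : Measure E) [IsProbabilityMeasure μ] {a b : κ → ι} (ha : Function.Injective a)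
    (hab : ∀ s t, b s ≠ a t) {r : Set (E × E)} (hr : MeasurableSet r) {p : ℝ≥0∞}
    (hp : ∀ y, μ {x | (x, y) ∈ r} ≤ p) :
    Measure.pi (fun _ : ι => μ) {x | ∀ t, (x (a t), x (b t)) ∈ r} ≤ p ^ Fintype.card κ := by
  classical
  let A : ι → Prop := fun i => i ∈ Set.range a
  let _ : Fintype {i // A i} := Subtype.fintype A
  have hb : ∀ t, ¬ A (b t) := by rintro t ⟨s, hs⟩; exact hab t s hs.symm
  let s : Set (({i // A i} → E) × ({i // ¬ A i} → E)) :=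
    {x | ∀ t, (x.1 ⟨a t, t, rfl⟩, x.2 ⟨b t, hb t⟩) ∈ r}
  have hs : MeasurableSet s := by
    have : s = ⋂ t, (fun x : ({i // A i} → E) × ({i // ¬ A i} → E) =>
        (x.1 ⟨a t, t, rfl⟩, x.2 ⟨b t, hb t⟩)) ⁻¹' r := by
      ext x; simp [s]
    rw [this]
    refine MeasurableSet.iInter fun t => hr.preimage ?_
    fun_prop
  have hmp := measurePreserving_piEquivPiSubtypeProd (fun _ : ι => μ) A
  have hpre : {x : ι → E | ∀ t, (x (a t), x (b t)) ∈ r} =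
      (MeasurableEquiv.piEquivPiSubtypeProd (fun _ : ι => E) A) ⁻¹' s := by
    ext x; rfl
  rw [hpre, hmp.measure_preimage hs.nullMeasurableSet, Measure.prod_apply_symm hs]
  have hfib : ∀ v : {i // ¬ A i} → E, Measure.pi (fun _ : {i // A i} => μ)
      ((fun u => (u, v)) ⁻¹' s) ≤ p ^ Fintype.card κ := by
    intro v
    have hbox : (fun u : {i // A i} → E => (u, v)) ⁻¹' s ⊆
        Set.univ.pi fun i : {i // A i} => {x | (x, v ⟨b i.2.choose, hb _⟩) ∈ r} := by
      intro u hu i _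
      have h := hu i.2.choose
      simp only [i.2.choose_spec] at h
      exact h
    refine (measure_mono hbox).trans ?_
    rw [Measure.pi_pi]
    refine (Finset.prod_le_prod' fun i _ => hp _).trans ?_
    rw [Finset.prod_const, Finset.card_univ]
    exact le_of_eq (by rw [← Fintype.card_congr (Equiv.ofInjective a ha)])
  refine (lintegral_mono hfib).trans ?_
  rw [lintegral_const]
  simp

end Random

/-! ### Random codebooks by the union bound. -/

section Codebook

variable {E : Type*} [NormedAddCommGroup E] [InnerProductSpace ℝ E] [FiniteDimensional ℝ E]
  [MeasurableSpace E] [BorelSpace E]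

/-- The random coding argument. In the first family of conclusions, few keys of a message give a
codeword that correlates with a codeword of another given message; in the second, few messages
have, for some choice of keys, codewords in a prescribed sequence of small balls. -/
lemma exists_codebook_of_lt {M I G T L : ℕ} {τ β : ℝ} (h0 : 0 < τ) (h1 : τ < 1)
    (hd : (1 - τ) ^ Module.finrank ℝ E ≤ 1 / 2) (hβ : 0 ≤ β)
    {B : Type*} [Fintype B] (S : B → Finset (Fin I)) (c : B → Fin I → E) (r : B → Fin I → ℝ)
    (hr : ∀ b j, 0 ≤ r b j)
    (hS : ∀ b, ∏ j ∈ S b, 2 * r b j ^ Module.finrank ℝ E ≤ β)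
    (hlt : (M : ℝ) ^ 2 * I * ((G : ℝ) * G * (2 * √(1 - τ ^ 2) ^ Module.finrank ℝ E)) ^ T +
      Fintype.card B * ((M : ℝ) * G ^ I * β) ^ L < 1) :
    ∃ z : Fin M → Fin I → Fin G → E, (∀ w j k, z w j k ∈ shell E τ) ∧
      (∀ w w', w ≠ w' → ∀ j,
        {k | ∃ k', τ < inner ℝ (z w j k) (z w' j k')}.ncard < T) ∧
      ∀ b, {w | ∃ κ : Fin I → Fin G, ∀ j ∈ S b,
        z w j (κ j) ∈ Metric.closedBall (c b j) (r b j)}.ncard < L := by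
  classical
  set μ : Measure E := shellMeasure E τ with hμ
  have : IsProbabilityMeasure μ := isProbabilityMeasure_shellMeasure h1 hd
  let ν : Measure (Fin M × Fin I × Fin G → E) := Measure.pi fun _ => μ
  set s : ℝ := √(1 - τ ^ 2) ^ Module.finrank ℝ E with hs
  have hs0 : 0 ≤ s := by positivity
  let bad₀ : Fin M × Fin I × Fin G → Set (Fin M × Fin I × Fin G → E) := fun i =>
    {x | x i ∉ shell E τ}
  let bad₁ : (Fin M × Fin M × Fin I) × (Fin T → Fin G × Fin G) →
      Set (Fin M × Fin I × Fin G → E) := fun q =>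
    {x | q.1.1 ≠ q.1.2.1 ∧ Function.Injective (fun t => (q.2 t).1) ∧ ∀ t,
      τ < inner ℝ (x (q.1.1, q.1.2.2, (q.2 t).1)) (x (q.1.2.1, q.1.2.2, (q.2 t).2))}
  let bad₂ : B × (Fin L → Fin M × (Fin I → Fin G)) →
      Set (Fin M × Fin I × Fin G → E) := fun q =>
    {x | Function.Injective (fun t => (q.2 t).1) ∧ ∀ t, ∀ j ∈ S q.1,
      x ((q.2 t).1, j, (q.2 t).2 j) ∈ Metric.closedBall (c q.1 j) (r q.1 j)}
  have hbad₀ : ∀ i, ν (bad₀ i) = 0 := by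
    intro i
    have h := (measurePreserving_eval (fun _ : Fin M × Fin I × Fin G => μ) i).measure_preimage
      (measurableSet_shell (E := E) τ).compl.nullMeasurableSet
    rw [hμ, shellMeasure_compl_shell] at h
    exact h
  have hz : ∀ᵐ x ∂ν, ∀ i, x i ∈ shell E τ := by
    rw [ae_all_iff]
    exact hbad₀
  have hbad₁ : ∀ q, ν (bad₁ q) ≤ ENNReal.ofReal ((2 * s) ^ T) := by
    rintro ⟨⟨w, w', j⟩, f⟩
    by_cases hw : w ≠ w' ∧ Function.Injective (fun t => (f t).1)
    swap
    · have : bad₁ ((w, w', j), f) = ∅ := by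
        ext x
        simp only [bad₁, Set.mem_ofPred_eq, Set.mem_empty_iff_false, iff_false]
        tauto
      rw [this]; simp
    -- The cap bound holds for `‖y‖ ≤ 1` only, whereas the product bound asks for all `y`. Adding
    -- the norm condition to the relation changes the event by a null set.
    have hmeas : MeasurableSet ({y : E × E | ‖y.2‖ ≤ 1} ∩ {y | τ < inner ℝ y.1 y.2}) := by
      refine (measurableSet_le ?_ ?_).inter (measurableSet_lt ?_ ?_) <;> fun_prop
    have h := pi_setOf_forall_rel_le (ι := Fin M × Fin I × Fin G) μ (κ := Fin T)
      (a := fun t => (w, j, (f t).1))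
      (b := fun t => (w', j, (f t).2)) (p := ENNReal.ofReal (2 * s))
      (fun t t' htt => hw.2 (by simpa using htt))
      (fun t t' h => hw.1 (by simpa using (congrArg Prod.fst h).symm)) hmeas (by
        intro y
        by_cases hy : ‖y‖ ≤ 1
        · refine (measure_mono ?_).trans (shellMeasure_cap_le h0 h1 hd hy)
          exact fun x hx => hx.2
        · simp [hy])
    rw [Fintype.card_fin, ← ENNReal.ofReal_pow (by positivity)] at h
    refine le_trans (measure_mono_ae ?_) h
    filter_upwards [hz] with x hx hxb
    intro t
    refine ⟨?_, hxb.2.2 t⟩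
    simpa using (hx (w', j, (f t).2)).1
  have hbad₂ : ∀ q, ν (bad₂ q) ≤ ENNReal.ofReal (β ^ L) := by
    rintro ⟨b, f⟩
    by_cases hf : Function.Injective (fun t => (f t).1)
    swap
    · have : bad₂ (b, f) = ∅ := by
        ext x
        simp only [bad₂, Set.mem_ofPred_eq, Set.mem_empty_iff_false, iff_false]
        tauto
      rw [this]; simp
    -- The messages are distinct, so all codewords involved are distinct coordinates and their ball
    -- events are independent.
    let e : Fin L × Fin I → Fin M × Fin I × Fin G := fun q => ((f q.1).1, q.2, (f q.1).2 q.2)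
    have he : Function.Injective e := by
      rintro ⟨t, j⟩ ⟨t', j'⟩ h
      simp only [e, Prod.mk.injEq] at h
      have := hf h.1
      simp [this, h.2.1]
    let A : Finset (Fin M × Fin I × Fin G) := (Finset.univ ×ˢ S b).image e
    have hsub : bad₂ (b, f) ⊆ Set.pi A fun i => Metric.closedBall (c b i.2.1) (r b i.2.1) := by
      rintro x hx i hi
      simp only [A, Finset.coe_image, Set.mem_image, Finset.mem_coe, Finset.mem_product,
        Finset.mem_univ, true_and] at hi
      obtain ⟨⟨t, j⟩, hj, rfl⟩ := hi
      exact hx.2 t j hj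
    refine (measure_mono hsub).trans ?_
    rw [Measure.pi_pi_finset, Finset.prod_image he.injOn, Finset.prod_product]
    simp only [Finset.prod_const, Finset.card_univ, Fintype.card_fin, e]
    rw [ENNReal.ofReal_pow hβ]
    gcongr
    refine (Finset.prod_le_prod' fun j _ => shellMeasure_le h1 hd (hr b j)
      Set.inter_subset_left).trans ?_
    rw [← ENNReal.ofReal_prod_of_nonneg fun j _ => by have := hr b j; positivity]
    exact ENNReal.ofReal_le_ofReal (hS b)
  have hunion₁ : ν (⋃ q, bad₁ q) ≤
      ENNReal.ofReal ((M : ℝ) ^ 2 * I * ((G : ℝ) * G * (2 * s)) ^ T) := by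
    refine (measure_iUnion_fintype_le ν bad₁).trans ?_
    refine (Finset.sum_le_sum fun q _ => hbad₁ q).trans ?_
    rw [Finset.sum_const, Finset.card_univ, nsmul_eq_mul, ← ENNReal.ofReal_natCast,
      ← ENNReal.ofReal_mul (by positivity)]
    refine ENNReal.ofReal_le_ofReal (le_of_eq ?_)
    simp only [Fintype.card_prod, Fintype.card_fin, Fintype.card_fun, Nat.cast_mul, Nat.cast_pow]
    ring
  have hunion₂ : ν (⋃ q, bad₂ q) ≤
      ENNReal.ofReal (Fintype.card B * ((M : ℝ) * G ^ I * β) ^ L) := by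
    refine (measure_iUnion_fintype_le ν bad₂).trans ?_
    refine (Finset.sum_le_sum fun q _ => hbad₂ q).trans ?_
    rw [Finset.sum_const, Finset.card_univ, nsmul_eq_mul, ← ENNReal.ofReal_natCast,
      ← ENNReal.ofReal_mul (by positivity)]
    refine ENNReal.ofReal_le_ofReal (le_of_eq ?_)
    simp only [Fintype.card_prod, Fintype.card_fin, Fintype.card_fun, Nat.cast_mul, Nat.cast_pow]
    ring
  have htot : ν ((⋃ q, bad₁ q) ∪ (⋃ q, bad₂ q)) < 1 := by
    refine (measure_union_le _ _).trans_lt ((add_le_add hunion₁ hunion₂).trans_lt ?_)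
    rw [← ENNReal.ofReal_add (by positivity) (by positivity), ← ENNReal.ofReal_one]
    exact (ENNReal.ofReal_lt_ofReal_iff one_pos).2 hlt
  obtain ⟨x, hxz, hxb⟩ : ∃ x, (∀ i, x i ∈ shell E τ) ∧
      x ∉ (⋃ q, bad₁ q) ∪ (⋃ q, bad₂ q) := by
    by_contra! hcon
    have hall : ∀ᵐ x ∂ν, x ∈ (⋃ q, bad₁ q) ∪ (⋃ q, bad₂ q) := by
      filter_upwards [hz] with x hx using hcon x hx
    have h1 : ν ((⋃ q, bad₁ q) ∪ (⋃ q, bad₂ q)) = ν Set.univ :=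
      measure_congr (Filter.eventuallyEq_univ.2 hall)
    rw [h1, measure_univ] at htot
    exact lt_irrefl _ htot
  simp only [Set.mem_union, Set.mem_iUnion, not_or, not_exists] at hxb
  refine ⟨fun w j k => x (w, j, k), fun w j k => hxz _, ?_, ?_⟩
  · intro w w' hw j
    by_contra! hcon
    set K : Set (Fin G) := {k | ∃ k', τ < inner ℝ (x (w, j, k)) (x (w', j, k'))} with hK
    obtain ⟨F, hF, hFc⟩ := Set.exists_subset_card_eq hcon
    have hcard : Nat.card F = T := hFc
    let e : Fin T ≃ F := (Finite.equivFinOfCardEq hcard).symm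
    have hch : ∀ t, ∃ k', τ < inner ℝ (x (w, j, (e t : Fin G))) (x (w', j, k')) :=
      fun t => hF (e t).2
    choose k' hk' using hch
    exact hxb.1 ((w, w', j), fun t => ((e t : Fin G), k' t))
      ⟨hw, fun t t' h => e.injective (Subtype.ext h), hk'⟩
  · intro b
    by_contra! hcon
    obtain ⟨F, hF, hFc⟩ := Set.exists_subset_card_eq hcon
    have hcard : Nat.card F = L := hFc
    let e : Fin L ≃ F := (Finite.equivFinOfCardEq hcard).symm
    have hch : ∀ t, ∃ κ : Fin I → Fin G, ∀ j ∈ S b,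
        x ((e t : Fin M), j, κ j) ∈ Metric.closedBall (c b j) (r b j) := fun t => hF (e t).2
    choose κ hκ using hch
    exact hxb.2 (b, fun t => ((e t : Fin M), κ t))
      ⟨fun t t' h => e.injective (Subtype.ext h), hκ⟩

end Codebook

/-! ### List decoding -/

section ListDecoding

variable {E : Type*} [NormedAddCommGroup E]

/-- The squared distance of `y` and `x` in units of `δ`, rounded down. -/
noncomputable def noiseIndex (δ : ℝ) (y x : E) : ℕ := ⌊‖y - x‖ ^ 2 / δ⌋₊

/-- The noise level with index `q`: the squared distance rounded up, and cut off at `1`. -/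
noncomputable def noiseLevel (δ : ℝ) (q : ℕ) : ℝ := min 1 (δ * (q + 1))

/-- The information, in nats and per pair of dimensions, that the first `i` blocks carry when
their noise indices are `q`. -/
noncomputable def prefixRate {I : ℕ} (δ : ℝ) (q : Fin I → ℕ) (i : ℕ) : ℝ :=
  ∑ j ∈ Finset.univ.filter (fun j : Fin I => (j : ℕ) < i), -Real.log (noiseLevel δ (q j))

lemma noiseLevel_pos {δ : ℝ} (hδ : 0 < δ) (q : ℕ) : 0 < noiseLevel δ q := by
  unfold noiseLevel; positivity

lemma noiseLevel_le_one (δ : ℝ) (q : ℕ) : noiseLevel δ q ≤ 1 := min_le_left _ _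

lemma noiseLevel_le (δ : ℝ) (q : ℕ) : noiseLevel δ q ≤ δ * (q + 1) := min_le_right _ _

lemma noiseIndex_mul_le {δ : ℝ} (hδ : 0 < δ) (y x : E) :
    δ * noiseIndex δ y x ≤ ‖y - x‖ ^ 2 := by
  have := Nat.floor_le (div_nonneg (sq_nonneg ‖y - x‖) hδ.le)
  rwa [le_div_iff₀ hδ, mul_comm] at this

lemma sq_norm_sub_le {δ : ℝ} (hδ : 0 < δ) (y x : E) :
    ‖y - x‖ ^ 2 ≤ δ * (noiseIndex δ y x + 1) := by
  have := (Nat.lt_floor_add_one (‖y - x‖ ^ 2 / δ)).le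
  rwa [div_le_iff₀ hδ, mul_comm] at this

/-- A pattern of blocks, of noise indices, and of points of a net around which the codewords of
the listed messages lie. -/
abbrev NetPattern (I V : ℕ) (t : Finset E) (δ Θ : ℝ) : Type _ :=
  {b : Finset (Fin I) × (Fin I → Fin V) × (Fin I → t) //
    Θ < ∑ j ∈ b.1, -Real.log (δ * ((b.2.1 j : ℕ) + 1))}

/-- Since `u j ≥ δ`, a net of mesh `ζ * √δ` enlarges each radius `√(u j)` by a factor of at most `1
+ ζ`. The product of the `√(u j)` is the exponential of minus half the information, which yields `Θ
/ 2`. -/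
lemma prod_two_mul_pow_le {I d : ℕ} {δ ζ Θ : ℝ} (hδ : 0 < δ) (hζ : 0 < ζ) (S : Finset (Fin I))
    (u : Fin I → ℝ) (hu : ∀ j, δ ≤ u j) (hΘ : Θ < ∑ j ∈ S, -Real.log (u j)) :
    ∏ j ∈ S, 2 * (√(u j) + ζ * √δ) ^ d ≤
      2 ^ I * (1 + ζ) ^ (I * d) * Real.exp (-(Θ / 2 * d)) := by
  have hu0 : ∀ j, 0 < u j := fun j => hδ.trans_le (hu j)
  have hcard : S.card ≤ I := by simpa using S.card_le_univ
  have h1 : ∏ j ∈ S, 2 * (√(u j) + ζ * √δ) ^ d ≤ ∏ j ∈ S, (2 * (1 + ζ) ^ d) * √(u j) ^ d := by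
    refine Finset.prod_le_prod (fun j _ => by positivity) fun j _ => ?_
    rw [mul_assoc, ← mul_pow]
    have : √δ ≤ √(u j) := Real.sqrt_le_sqrt (hu j)
    gcongr
    nlinarith
  refine h1.trans ?_
  rw [Finset.prod_mul_distrib, Finset.prod_const, Finset.prod_pow]
  have h2 : (2 * (1 + ζ) ^ d) ^ S.card ≤ 2 ^ I * (1 + ζ) ^ (I * d) := by
    calc (2 * (1 + ζ) ^ d) ^ S.card ≤ (2 * (1 + ζ) ^ d) ^ I :=
          pow_le_pow_right₀ (by nlinarith [one_le_pow₀ (by linarith : 1 ≤ 1 + ζ) (n := d)]) hcard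
      _ = _ := by rw [mul_pow, ← pow_mul, mul_comm d]
  have h3 : (∏ j ∈ S, √(u j)) ^ d ≤ Real.exp (-(Θ / 2 * d)) := by
    have h4 : ∏ j ∈ S, √(u j) = Real.exp (-((∑ j ∈ S, -Real.log (u j)) / 2)) := by
      rw [Finset.sum_neg_distrib, neg_div, neg_neg, Finset.sum_div, Real.exp_sum]
      refine Finset.prod_congr rfl fun j _ => ?_
      rw [← Real.log_sqrt (hu0 j).le, Real.exp_log (Real.sqrt_pos.2 (hu0 j))]
    rw [h4, ← Real.exp_nat_mul]
    refine Real.exp_le_exp.2 ?_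
    have hd : (0 : ℝ) ≤ d := d.cast_nonneg
    nlinarith
  gcongr

/-- Rounding the received blocks to the net reduces the uncountably many `y` to finitely many
patterns. For a given `y` the net points are fixed, and the listed messages split according to the
informative blocks and their noise indices, at most `2 ^ I * V ^ I` classes of at most `L` messages
each. -/
lemma ncard_list_le {M I G V L : ℕ} {δ ζ Θ : ℝ} (hδ : 0 < δ) (hV : 1 / δ ≤ V) {t : Finset E}
    (ht0 : t.Nonempty) (ht : ∀ x : E, ‖x‖ ≤ 2 → ∃ y ∈ t, dist x y ≤ ζ * √δ)
    {z : Fin M → Fin I → Fin G → E} (hz : ∀ w j k, ‖z w j k‖ ≤ 1)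
    (hB : ∀ b : NetPattern I V t δ Θ, {w | ∃ κ : Fin I → Fin G, ∀ j ∈ b.1.1,
        z w j (κ j) ∈ Metric.closedBall (b.1.2.2 j : E)
          (√(δ * ((b.1.2.1 j : ℕ) + 1)) + ζ * √δ)}.ncard < L) (y : Fin I → E) (i : ℕ) :
    {w | ∃ κ : Fin I → Fin G,
        Θ < prefixRate δ (fun j => noiseIndex δ (y j) (z w j (κ j))) i}.ncard ≤
      2 ^ I * V ^ I * L := by
  classical
  have hV0 : 0 < V := by
    have : (0 : ℝ) < V := (by positivity : 0 < 1 / δ).trans_le hV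
    exact_mod_cast this
  have hnet : ∀ j, ∃ c : t, ‖y j‖ ≤ 2 → dist (y j) c ≤ ζ * √δ := by
    intro j
    by_cases h : ‖y j‖ ≤ 2
    · obtain ⟨c, hc, hd⟩ := ht _ h
      exact ⟨⟨c, hc⟩, fun _ => hd⟩
    · exact ⟨⟨ht0.choose, ht0.choose_spec⟩, fun h' => absurd h' h⟩
  choose c hc using hnet
  let D : Finset (Fin I) × (Fin I → Fin V) → Set (Fin M) := fun b =>
    {w | Θ < ∑ j ∈ b.1, -Real.log (δ * ((b.2 j : ℕ) + 1)) ∧ ∃ κ : Fin I → Fin G, ∀ j ∈ b.1,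
      z w j (κ j) ∈ Metric.closedBall (c j : E) (√(δ * ((b.2 j : ℕ) + 1)) + ζ * √δ)}
  have hD : ∀ b, (D b).ncard ≤ L := by
    rintro ⟨S, q⟩
    by_cases h : Θ < ∑ j ∈ S, -Real.log (δ * ((q j : ℕ) + 1))
    · refine le_trans (Set.ncard_le_ncard ?_ (Set.toFinite _)) (hB ⟨(S, q, c), h⟩).le
      exact fun w hw => hw.2
    · have : D (S, q) = ∅ := by
        ext w
        simp only [D, Set.mem_ofPred_eq, Set.mem_empty_iff_false, iff_false]
        tauto
      simp [this]
  have hsub : {w | ∃ κ : Fin I → Fin G,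
        Θ < prefixRate δ (fun j => noiseIndex δ (y j) (z w j (κ j))) i} ⊆
      ((Finset.univ : Finset (Finset (Fin I) × (Fin I → Fin V))).biUnion
        fun b => (D b).toFinset : Finset (Fin M)) := by
    rintro w ⟨κ, hκ⟩
    set q : Fin I → ℕ := fun j => noiseIndex δ (y j) (z w j (κ j)) with hq
    -- Blocks whose noise level is cut off at `1` carry no information and are dropped. In the
    -- others the noise has norm at most `1`, so the received block lies within the reach of the net
    -- and its index is below `V`.
    let S : Finset (Fin I) := {j | (j : ℕ) < i ∧ δ * (q j + 1) < 1}
    have hqV : ∀ j ∈ S, q j < V := by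
      intro j hj
      simp only [S, Finset.mem_filter_univ] at hj
      have : ((q j : ℝ) + 1) < 1 / δ := by
        rw [lt_div_iff₀ hδ, mul_comm]; exact hj.2
      have h2 : (q j : ℝ) < V := by linarith
      exact_mod_cast h2
    let q' : Fin I → Fin V := fun j => if h : q j < V then ⟨q j, h⟩ else ⟨0, hV0⟩
    have hq' : ∀ j ∈ S, ((q' j : ℕ) : ℝ) = q j := by
      intro j hj
      simp only [q', dif_pos (hqV j hj)]
    have hsum : prefixRate δ q i = ∑ j ∈ S, -Real.log (δ * ((q' j : ℕ) + 1)) := by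
      have hS : S ⊆ Finset.univ.filter (fun j : Fin I => (j : ℕ) < i) := by
        intro j hj
        simp only [S, Finset.mem_filter_univ] at hj ⊢
        exact hj.1
      rw [prefixRate, ← Finset.sum_subset hS]
      · refine Finset.sum_congr rfl fun j hj => ?_
        rw [hq' j hj]
        simp only [S, Finset.mem_filter_univ] at hj
        rw [noiseLevel, min_eq_right hj.2.le]
      · intro j hj hj'
        simp only [S, Finset.mem_filter_univ] at hj hj'
        rw [noiseLevel, min_eq_left, Real.log_one, neg_zero]
        by_contra! h
        exact hj' ⟨hj, h⟩
    simp only [Finset.coe_biUnion, Finset.coe_univ, Set.mem_univ, Set.iUnion_true, Set.mem_iUnion,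
      Finset.mem_coe, Set.mem_toFinset]
    refine ⟨(S, q'), hsum ▸ hκ, κ, fun j hj => ?_⟩
    rw [hq' j hj]
    have h1 : ‖y j - z w j (κ j)‖ ^ 2 ≤ δ * (q j + 1) := sq_norm_sub_le hδ _ _
    have h2 : ‖y j - z w j (κ j)‖ ≤ √(δ * (q j + 1)) := Real.le_sqrt_of_sq_le h1
    have h3 : ‖y j - z w j (κ j)‖ ≤ 1 := by
      simp only [S, Finset.mem_filter_univ] at hj
      exact h2.trans (Real.sqrt_le_one.2 hj.2.le)
    have h4 : ‖y j‖ ≤ 2 := by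
      have := norm_add_le (y j - z w j (κ j)) (z w j (κ j))
      rw [sub_add_cancel] at this
      linarith [hz w j (κ j)]
    rw [Metric.mem_closedBall]
    refine (dist_triangle _ (y j) _).trans (add_le_add ?_ (hc j h4))
    rwa [dist_comm, dist_eq_norm]
  refine (Set.ncard_le_ncard hsub (Set.toFinite _)).trans ?_
  rw [Set.ncard_coe_finset]
  refine (Finset.card_biUnion_le_card_mul _ _ L fun b _ => ?_).trans (le_of_eq ?_)
  · rw [← Set.ncard_eq_toFinset_card']
    exact hD b
  · simp

end ListDecoding

/-! ### Existence of good codebooks -/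

/-- The power `T` multiplies the decay rate `β`, and `β * T ≥ α + 1` beats the growth rate `α`. -/
lemma exists_pow_mul_exp_lt (C b α : ℝ) {β : ℝ} (hβ : 0 < β) (hC : 0 ≤ C) (hb : 0 ≤ b) :
    ∃ T : ℕ, ∀ᶠ l : ℕ in Filter.atTop,
      C * Real.exp (α * l) * (b * Real.exp (-(β * l))) ^ T < 1 / 2 := by
  obtain ⟨T, hT⟩ := exists_nat_ge ((α + 1) / β)
  refine ⟨T, ?_⟩
  rw [div_le_iff₀ hβ] at hT
  have hlim : Filter.Tendsto (fun l : ℕ => C * b ^ T * Real.exp (-(l : ℝ))) Filter.atTop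
      (nhds (C * b ^ T * 0)) :=
    ((Real.tendsto_exp_neg_atTop_nhds_zero).comp tendsto_natCast_atTop_atTop).const_mul _
  rw [mul_zero] at hlim
  filter_upwards [hlim.eventually_lt_const (by norm_num : (0 : ℝ) < 1 / 2)] with l hl
  refine lt_of_le_of_lt ?_ hl
  rw [mul_pow, ← Real.exp_nat_mul]
  have : C * Real.exp (α * l) * (b ^ T * Real.exp (T * -(β * l))) =
      C * b ^ T * Real.exp (α * l + T * -(β * l)) := by rw [Real.exp_add]; ring
  rw [this]
  gcongr
  have hl0 : (0 : ℝ) ≤ l := l.cast_nonneg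
  nlinarith

set_option maxHeartbeats 1000000 in
/-- Codebooks in which codewords of different messages are nearly orthogonal for most keys, and
which are list decodable from every prefix that carries more information than the messages. -/
theorem exists_codebook (I : ℕ) {a ρ Θ τ δ : ℝ} (ha : 0 ≤ a) (h0 : 0 < τ) (h1 : τ < 1)
    (hδ : 0 < δ) (hΘ : ρ < Θ / 2) :
    ∃ g : ℝ, 0 < g ∧ ∃ T : ℕ, ∀ᶠ l : ℕ in Filter.atTop, ∀ M : ℕ, (M : ℝ) ≤ a * Real.exp (ρ * l) →
      ∃ G : ℕ, Real.exp (g * l) ≤ G ∧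
        ∃ z : Fin M → Fin I → Fin G → EuclideanSpace ℝ (Fin l),
          (∀ w j k, 1 - τ ≤ ‖z w j k‖ ∧ ‖z w j k‖ ≤ 1) ∧
          (∀ w w', w ≠ w' → ∀ j,
            {k | ∃ k', τ < inner ℝ (z w j k) (z w' j k')}.ncard ≤ T) ∧
          ∀ (y : Fin I → EuclideanSpace ℝ (Fin l)) (i : ℕ),
            {w | ∃ κ : Fin I → Fin G,
              Θ < prefixRate δ (fun j => noiseIndex δ (y j) (z w j (κ j))) i}.ncard ≤ T := by
  -- The gap `Θ / 2 - ρ = 2 * κ₀` pays for the choices of keys (`I * g`) and for the enlarged radii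
  -- (`I * ζ`), at most `κ₀ / 2` each, and leaves the exponent `κ₀`. The bound `g ≤ τ² / 8` lets the
  -- `G²` pairs of keys use up at most half of the cap exponent `τ² / 2`.
  set κ₀ : ℝ := (Θ / 2 - ρ) / 2 with hκ₀
  have hκ₀p : 0 < κ₀ := by rw [hκ₀]; linarith
  set ζ : ℝ := κ₀ / (2 * (I + 1)) with hζ
  have hζp : 0 < ζ := by positivity
  set g : ℝ := min (τ ^ 2 / 8) ζ with hg
  have hgp : 0 < g := by positivity
  have hIζ : I * ζ ≤ κ₀ / 2 := by
    rw [hζ, mul_div_assoc', div_le_div_iff₀ (by positivity) (by norm_num)]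
    nlinarith
  set V : ℕ := ⌈1 / δ⌉₊ with hV
  set γ : ℝ := ζ * √δ with hγ
  have hγp : 0 < γ := by positivity
  obtain ⟨T, hT⟩ := exists_pow_mul_exp_lt (a ^ 2 * I) 8 (2 * ρ) (β := τ ^ 2 / 4) (by positivity)
    (by positivity) (by norm_num)
  obtain ⟨L, hL⟩ := exists_pow_mul_exp_lt (2 ^ I * V ^ I) (a * 4 ^ I)
    (I * Real.log (2 * 2 / γ + 1)) (β := κ₀) hκ₀p (by positivity) (by positivity)
  have hdim : ∀ᶠ l : ℕ in Filter.atTop, (1 - τ) ^ l ≤ 1 / 2 :=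
    ((tendsto_pow_atTop_nhds_zero_of_lt_one (by linarith) (by linarith)).eventually_lt_const
      (by norm_num)).mono fun l hl => hl.le
  refine ⟨g, hgp, max T (2 ^ I * V ^ I * L), ?_⟩
  filter_upwards [hT, hL, hdim] with l hTl hLl hdl M hM
  have hl0 : (0 : ℝ) ≤ l := l.cast_nonneg
  set G : ℕ := ⌈Real.exp (g * l)⌉₊ with hG
  have hG1 : Real.exp (g * l) ≤ G := Nat.le_ceil _
  have hG2 : (G : ℝ) ≤ 2 * Real.exp (g * l) := by
    have h := (Nat.ceil_lt_add_one (Real.exp_pos (g * l)).le).le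
    have h' : 1 ≤ Real.exp (g * l) := Real.one_le_exp (by positivity)
    rw [← hG] at h
    linarith
  refine ⟨G, hG1, ?_⟩
  have hfin : Module.finrank ℝ (EuclideanSpace ℝ (Fin l)) = l := by simp
  obtain ⟨t, ht0, htc, htn⟩ :=
    exists_net (E := EuclideanSpace ℝ (Fin l)) (R := 2) (by norm_num) hγp
  rw [hfin] at htc
  set β : ℝ := 2 ^ I * (1 + ζ) ^ (I * l) * Real.exp (-(Θ / 2 * l)) with hβ
  have hβ0 : 0 ≤ β := by positivity
  have hcap : (G : ℝ) * G * (2 * √(1 - τ ^ 2) ^ l) ≤ 8 * Real.exp (-(τ ^ 2 / 4 * l)) := by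
    have hs : √(1 - τ ^ 2) ^ l ≤ Real.exp (-(τ ^ 2 / 2 * l)) := by
      have : √(1 - τ ^ 2) ≤ Real.exp (-(τ ^ 2 / 2)) := by
        rw [Real.sqrt_le_left (Real.exp_pos _).le, ← Real.exp_nat_mul]
        refine (Real.one_sub_le_exp_neg (τ ^ 2)).trans (Real.exp_le_exp.2 ?_)
        push_cast; linarith
      refine (pow_le_pow_left₀ (Real.sqrt_nonneg _) this l).trans (le_of_eq ?_)
      rw [← Real.exp_nat_mul]; congr 1; ring
    calc (G : ℝ) * G * (2 * √(1 - τ ^ 2) ^ l)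
        ≤ (2 * Real.exp (g * l)) * (2 * Real.exp (g * l)) *
          (2 * Real.exp (-(τ ^ 2 / 2 * l))) := by gcongr
      _ = 8 * Real.exp (g * l + g * l + -(τ ^ 2 / 2 * l)) := by
          rw [Real.exp_add, Real.exp_add]; ring
      _ ≤ 8 * Real.exp (-(τ ^ 2 / 4 * l)) := by
          gcongr
          have : g ≤ τ ^ 2 / 8 := min_le_left _ _
          nlinarith
  have hlist : (M : ℝ) * G ^ I * β ≤ a * 4 ^ I * Real.exp (-(κ₀ * l)) := by
    have h2 : (1 + ζ) ^ (I * l) ≤ Real.exp (I * ζ * l) := by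
      have : 1 + ζ ≤ Real.exp ζ := by linarith [Real.add_one_le_exp ζ]
      refine (pow_le_pow_left₀ (by positivity) this _).trans (le_of_eq ?_)
      rw [← Real.exp_nat_mul]; congr 1; push_cast; ring
    calc (M : ℝ) * G ^ I * β
        ≤ (a * Real.exp (ρ * l)) * (2 * Real.exp (g * l)) ^ I *
          (2 ^ I * Real.exp (I * ζ * l) * Real.exp (-(Θ / 2 * l))) := by
          rw [hβ]; gcongr
      _ = a * 4 ^ I * Real.exp (ρ * l + I * (g * l) + I * ζ * l + -(Θ / 2 * l)) := by
          rw [Real.exp_add, Real.exp_add, Real.exp_add, mul_pow, ← Real.exp_nat_mul,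
            show (4 : ℝ) = 2 * 2 by norm_num, mul_pow]
          ring
      _ ≤ a * 4 ^ I * Real.exp (-(κ₀ * l)) := by
          gcongr
          have hgζ : g ≤ ζ := min_le_right _ _
          have : I * g ≤ κ₀ / 2 := le_trans (by gcongr) hIζ
          have h5 : ρ + I * g + I * ζ - Θ / 2 ≤ -κ₀ := by linarith
          nlinarith
  have hnum : (Fintype.card (NetPattern I V t δ Θ) : ℝ) ≤
      2 ^ I * V ^ I * Real.exp (I * Real.log (2 * 2 / γ + 1) * l) := by
    have h2 : Fintype.card (NetPattern I V t δ Θ) ≤ 2 ^ I * (V ^ I * t.card ^ I) := by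
      refine (Fintype.card_subtype_le _).trans (le_of_eq ?_)
      simp
    have h3 : (t.card : ℝ) ^ I ≤ Real.exp (I * Real.log (2 * 2 / γ + 1) * l) := by
      refine (pow_le_pow_left₀ (by positivity) htc I).trans (le_of_eq ?_)
      rw [← pow_mul, ← Real.exp_log (by positivity : 0 < (2 * 2 / γ + 1) ^ (l * I)), Real.log_pow]
      congr 1; push_cast; ring
    calc (Fintype.card (NetPattern I V t δ Θ) : ℝ) ≤ 2 ^ I * (V ^ I * t.card ^ I) := by
          exact_mod_cast h2
      _ ≤ _ := by rw [mul_assoc]; gcongr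
  obtain ⟨z, hz, hz1, hz2⟩ := exists_codebook_of_lt (E := EuclideanSpace ℝ (Fin l)) (M := M)
    (I := I) (G := G) (T := T) (L := L) (τ := τ) (β := β) h0 h1 (by rwa [hfin]) hβ0
    (B := NetPattern I V t δ Θ) (fun b => b.1.1) (fun b j => (b.1.2.2 j : _))
    (fun b j => √(δ * ((b.1.2.1 j : ℕ) + 1)) + γ) (fun b j => by positivity)
    (by
      intro b
      rw [hfin]
      refine prod_two_mul_pow_le hδ hζp b.1.1 (fun j => δ * ((b.1.2.1 j : ℕ) + 1)) (fun j => ?_) b.2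
      have : (0 : ℝ) ≤ ((b.1.2.1 j : ℕ) : ℝ) := Nat.cast_nonneg _
      nlinarith)
    (by
      rw [hfin]
      have hA : (M : ℝ) ^ 2 * I * ((G : ℝ) * G * (2 * √(1 - τ ^ 2) ^ l)) ^ T < 1 / 2 := by
        refine lt_of_le_of_lt ?_ hTl
        have hM2 : (M : ℝ) ^ 2 ≤ a ^ 2 * Real.exp (2 * ρ * l) := by
          refine (pow_le_pow_left₀ (by positivity) hM 2).trans (le_of_eq ?_)
          rw [mul_pow, ← Real.exp_nat_mul]; congr 2; push_cast; ring
        calc (M : ℝ) ^ 2 * I * ((G : ℝ) * G * (2 * √(1 - τ ^ 2) ^ l)) ^ T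
            ≤ (a ^ 2 * Real.exp (2 * ρ * l)) * I * (8 * Real.exp (-(τ ^ 2 / 4 * l))) ^ T := by
              gcongr
          _ = _ := by ring
      have hB : (Fintype.card (NetPattern I V t δ Θ) : ℝ) * ((M : ℝ) * G ^ I * β) ^ L < 1 / 2 := by
        refine lt_of_le_of_lt ?_ hLl
        gcongr
      linarith)
  have hz' : ∀ w j k, 1 - τ ≤ ‖z w j k‖ ∧ ‖z w j k‖ ≤ 1 := by
    intro w j k
    have h := hz w j k
    simp only [shell, Set.mem_sdiff, Metric.mem_closedBall, Metric.mem_ball, dist_zero_right,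
      not_lt] at h
    exact ⟨h.2, h.1⟩
  refine ⟨z, hz', fun w w' hw j => (hz1 w w' hw j).le.trans (le_max_left _ _), fun y i => ?_⟩
  exact (ncard_list_le hδ (Nat.le_ceil _) ht0 htn (fun w j k => (hz' w j k).2) hz2 y i).trans
    (le_max_right _ _)

/-! ### The optimization -/

section Optimization

variable {n : ℕ} {P N : ℝ} {p : Fin n → ℝ}

lemma objective_nonneg {a : (Fin n → ℝ) × Fin n}
    (ha : a ∈ feasibleAttacks n P N p) : 0 ≤ objective n p a := by
  refine mul_nonneg (by positivity) (Finset.sum_nonneg fun t ht => ?_)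
  refine Real.logb_nonneg (by norm_num) ?_
  rw [one_le_div (ha.1.1 t)]
  exact ha.2.1 t (Finset.mem_Iic.1 ht)

lemma iInf_objective_le {a : (Fin n → ℝ) × Fin n}
    (ha : a ∈ feasibleAttacks n P N p) :
    ⨅ a : feasibleAttacks n P N p, objective n p a ≤ objective n p a :=
  ciInf_le (f := fun a : feasibleAttacks n P N p => objective n p a)
    ⟨0, by rintro _ ⟨b, rfl⟩; exact objective_nonneg b.2⟩ ⟨a, ha⟩

/-- Noise proportional to the signal over the whole block. Its value does not depend on `p`, so it
bounds the supremum defining `optimalValue` and shows that the infima are over nonempty sets. -/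
lemma exists_feasibleAttack (hn : 0 < n) (hP : 0 < P) (hN : 0 < N) (hp : p ∈ signalPowerSet n P) :
    ∃ a ∈ feasibleAttacks n P N p, objective n p a = 1 / 2 * Real.logb 2 (min 1 (N / P))⁻¹ := by
  set c := min 1 (N / P) with hc
  have hc0 : 0 < c := by positivity
  have hc1 : c ≤ 1 := min_le_left _ _
  have huniv : Finset.Iic (⟨n - 1, by omega⟩ : Fin n) = Finset.univ := by
    ext t
    simp only [Finset.mem_Iic, Finset.mem_univ, iff_true, Fin.le_def]
    omega
  have hsum : ∑ t, c * p t ≤ n * N := by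
    rw [← Finset.mul_sum, hp.2]
    have : c * P ≤ N := by
      rw [← le_div_iff₀ hP]; exact min_le_right _ _
    nlinarith [(Nat.cast_nonneg n : (0 : ℝ) ≤ n)]
  refine ⟨(fun t => c * p t, ⟨n - 1, by omega⟩),
    ⟨⟨fun t => mul_pos hc0 (hp.1 t), hsum⟩, fun t _ => ?_, ?_⟩, ?_⟩
  · exact mul_le_of_le_one_left (hp.1 t).le hc1
  · simp only [huniv]
    rw [hp.2, ← Finset.mul_sum]
    linarith
  · have h : ∀ t, p t / (c * p t) = c⁻¹ := fun t => by
      have := (hp.1 t).ne'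
      field_simp
    have hn' : (n : ℝ) ≠ 0 := by positivity
    simp only [objective, huniv, h, Finset.sum_const, Finset.card_univ, Fintype.card_fin,
      nsmul_eq_mul]
    field_simp

lemma signalPowerSet_nonempty (hP : 0 < P) : (signalPowerSet n P).Nonempty :=
  ⟨fun _ => P, fun _ => hP, by simp⟩

lemma iInf_objective_le_optimalValue (hn : 0 < n) (hP : 0 < P) (hN : 0 < N)
    (hp : p ∈ signalPowerSet n P) :
    ⨅ a : feasibleAttacks n P N p, objective n p a ≤ optimalValue n P N := by
  refine le_ciSup (f := fun p : signalPowerSet n P =>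
    ⨅ a : feasibleAttacks n P N p, objective n p a)
    ⟨1 / 2 * Real.logb 2 (min 1 (N / P))⁻¹, ?_⟩ ⟨p, hp⟩
  rintro _ ⟨q, rfl⟩
  obtain ⟨a, ha, hav⟩ := exists_feasibleAttack hn hP hN q.2
  exact (iInf_objective_le ha).trans hav.le

lemma exists_signalPower_near_optimal (hP : 0 < P) {ε : ℝ} (hε : 0 < ε) :
    ∃ p ∈ signalPowerSet n P, ∀ a ∈ feasibleAttacks n P N p,
      optimalValue n P N - ε ≤ objective n p a := by
  have : Nonempty (signalPowerSet n P) := (signalPowerSet_nonempty hP).to_subtype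
  obtain ⟨p, hp⟩ := exists_lt_of_lt_ciSup (f := fun p : signalPowerSet n P =>
    ⨅ a : feasibleAttacks n P N p, objective n p a)
    (show optimalValue n P N - ε < ⨆ p : signalPowerSet n P, _ from sub_lt_self _ hε)
  exact ⟨p, p.2, fun a ha => hp.le.trans (iInf_objective_le ha)⟩

/-- The optimal value hardly increases when a long block is averaged over `K` groups. -/
lemma optimalValue_le_mul {K m : ℕ} (hK : 0 < K) (hm : K ≤ m) (hP : 0 < P) (hN : 0 < N) :
    optimalValue m P N ≤ (1 + (K : ℝ) ^ 2 / m) * optimalValue K P N := by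
  have hm0 : 0 < m := by omega
  have hK' : (0 : ℝ) < K := by positivity
  have hm' : (0 : ℝ) < m := by positivity
  set F : ℝ := 1 + (K : ℝ) ^ 2 / m with hF
  have hF0 : 0 < F := by positivity
  have : Nonempty (signalPowerSet m P) := (signalPowerSet_nonempty hP).to_subtype
  refine ciSup_le fun ⟨p', hp'⟩ => ?_
  set g : ℕ := m / K with hg
  have hgpos : 0 < g := Nat.div_pos hm hK
  have hgm : K * g ≤ m := Nat.mul_div_le m K
  have hmg : m < K * g + K := by
    have := Nat.lt_mul_div_succ m hK
    rw [← hg] at this; nlinarith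
  -- The last group also takes the remainder, so each group has at most `g + K ≤ (m / K) * F`
  -- elements.
  let grp : Fin m → Fin K := fun t => ⟨min (t / g) (K - 1), by omega⟩
  let fib : Fin K → Finset (Fin m) := fun k => Finset.univ.filter fun t => grp t = k
  have hfib_ne : ∀ k, (fib k).Nonempty := by
    intro k
    have hk : (k : ℕ) * g < m := by
      have h1 : ((k : ℕ) + 1) * g ≤ K * g := Nat.mul_le_mul_right g k.2
      nlinarith
    refine ⟨⟨k * g, hk⟩, ?_⟩
    simp only [fib, grp, Finset.mem_filter_univ, Fin.ext_iff, Nat.mul_div_cancel _ hgpos]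
    omega
  have hfib_card : ∀ k, ((fib k).card : ℝ) ≤ m / K * F := by
    intro k
    have h1 : (fib k).card ≤ g + K := by
      have hmaps : ∀ t ∈ fib k, (t : ℕ) ∈ Finset.Ico ((k : ℕ) * g) (k * g + (g + K)) := by
        intro t ht
        simp only [fib, grp, Finset.mem_filter_univ, Fin.ext_iff] at ht
        have hd1 : (t : ℕ) / g * g ≤ t := Nat.div_mul_le_self _ _
        have hd2 : (t : ℕ) < (t / g + 1) * g := by
          have := Nat.lt_mul_div_succ (t : ℕ) hgpos
          rwa [mul_comm] at this
        rw [Finset.mem_Ico]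
        rcases le_total ((t : ℕ) / g) (K - 1) with h | h
        · rw [min_eq_left h] at ht
          rw [ht] at hd1 hd2
          constructor <;> nlinarith
        · rw [min_eq_right h] at ht
          have hkK : K = k + 1 := by have := k.2; omega
          have h2 : (k : ℕ) * g ≤ t / g * g := Nat.mul_le_mul_right g (by omega)
          have h3 := t.2
          refine ⟨by omega, ?_⟩
          have h4 : K * g = k * g + g := (congrArg (· * g) hkK).trans (by ring)
          omega
      have := Finset.card_le_card_of_injOn (fun t : Fin m => (t : ℕ)) hmaps
        (fun a _ b _ h => Fin.ext h)
      simpa using this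
    have h2 : ((fib k).card : ℝ) ≤ g + K := by exact_mod_cast h1
    have h3 : (g : ℝ) ≤ m / K := Nat.cast_div_le
    have h4 : (m : ℝ) / K * F = m / K + K := by rw [hF]; field_simp
    linarith
  have hsum_le : ∀ (k₀ : Fin K) (f : Fin m → ℝ),
      ∑ t ∈ Finset.univ.filter (fun t => grp t ≤ k₀), f t =
        ∑ k ∈ Finset.Iic k₀, ∑ t ∈ fib k, f t := by
    intro k₀ f
    rw [← Finset.sum_fiberwise_of_maps_to (t := Finset.Iic k₀) (g := grp)
      (fun t ht => by simpa using ht)]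
    refine Finset.sum_congr rfl fun k hk => Finset.sum_congr ?_ fun _ _ => rfl
    ext t
    simp only [fib, Finset.mem_filter, Finset.mem_univ, true_and, Finset.mem_Iic] at hk ⊢
    exact ⟨fun h => h.2, fun h => ⟨h ▸ hk, h⟩⟩
  have hsum : ∀ f : Fin m → ℝ, ∑ t, f t = ∑ k, ∑ t ∈ fib k, f t := fun f =>
    (Finset.sum_fiberwise Finset.univ grp f).symm
  set p : Fin K → ℝ := fun k => (K / m) * ∑ t ∈ fib k, p' t with hpdef
  have hfp : ∀ k, ∑ t ∈ fib k, p' t = m / K * p k := fun k => by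
    rw [hpdef]; field_simp
  have hp : p ∈ signalPowerSet K P := by
    refine ⟨fun k => mul_pos (by positivity) (Finset.sum_pos (fun t _ => hp'.1 t) (hfib_ne k)), ?_⟩
    rw [hpdef, ← Finset.mul_sum, ← hsum, hp'.2]
    field_simp
  -- An attack on the group averages lifts to the long block with the noise-to-signal ratio of each
  -- group. All energy sums scale by `m / K`; only the group sizes, which weight the logarithms,
  -- cost the factor `F`.
  have key : ∀ a ∈ feasibleAttacks K P N p, ∃ a' ∈ feasibleAttacks m P N p',
      objective m p' a' ≤ F * objective K p a := by
    rintro ⟨q, k₀⟩ ⟨⟨hq0, hqs⟩, hqp, hqe⟩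
    simp only at hq0 hqs hqp hqe
    set q' : Fin m → ℝ := fun t => p' t * (q (grp t) / p (grp t)) with hq'
    have hfq : ∀ k, ∑ t ∈ fib k, q' t = m / K * q k := by
      intro k
      have : ∑ t ∈ fib k, q' t = ∑ t ∈ fib k, p' t * (q k / p k) := by
        refine Finset.sum_congr rfl fun t ht => ?_
        simp only [fib, Finset.mem_filter_univ] at ht
        rw [hq']; simp only [ht]
      rw [this, ← Finset.sum_mul, hfp]
      have := (hp.1 k).ne'
      field_simp
    have hne : (Finset.univ.filter (fun t => grp t ≤ k₀)).Nonempty := by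
      obtain ⟨t, ht⟩ := hfib_ne k₀
      simp only [fib, Finset.mem_filter_univ] at ht
      exact ⟨t, by simp [ht]⟩
    set t₀ := (Finset.univ.filter (fun t => grp t ≤ k₀)).max' hne with ht₀
    have hIic : Finset.Iic t₀ = Finset.univ.filter (fun t => grp t ≤ k₀) := by
      ext t
      simp only [Finset.mem_Iic, Finset.mem_filter_univ]
      constructor
      · intro h
        have h1 : grp t₀ ≤ k₀ := by
          simpa using Finset.max'_mem _ hne
        refine le_trans ?_ h1
        simp only [grp, Fin.mk_le_mk]
        exact min_le_min_right _ (Nat.div_le_div_right h)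
      · intro h
        exact Finset.le_max' _ _ (by simpa using h)
    refine ⟨(q', t₀), ⟨⟨fun t => mul_pos (hp'.1 t) (div_pos (hq0 _) (hp.1 _)), ?_⟩, ?_, ?_⟩, ?_⟩
    · rw [hsum]
      simp only [hfq]
      rw [← Finset.mul_sum]
      calc (m : ℝ) / K * ∑ k, q k ≤ m / K * (K * N) := by gcongr
        _ = m * N := by field_simp
    · intro t ht
      have h1 : t ∈ Finset.Iic t₀ := Finset.mem_Iic.2 ht
      rw [hIic, Finset.mem_filter_univ] at h1
      exact mul_le_of_le_one_right (hp'.1 t).le ((div_le_one (hp.1 _)).2 (hqp _ h1))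
    · simp only [hIic, hsum_le, hfp, ← Finset.mul_sum, hfq]
      have h0 : ∑ k ∈ Finset.Iic k₀, 2 * q k = 2 * ∑ k ∈ Finset.Iic k₀, q k :=
        (Finset.mul_sum _ _ _).symm
      rw [h0] at hqe
      have h1 := mul_le_mul_of_nonneg_left hqe (by positivity : (0 : ℝ) ≤ m / K)
      have h2 : (m : ℝ) * P = m / K * (K * P) := by field_simp
      have h3 : 2 * ((m : ℝ) * N) = m / K * (2 * (K * N)) := by field_simp
      rw [h2, h3]
      linarith
    · simp only [objective, hIic, hsum_le]
      have h1 : ∀ k ∈ Finset.Iic k₀, ∑ t ∈ fib k, Real.logb 2 (p' t / q' t) ≤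
          m / K * F * Real.logb 2 (p k / q k) := by
        intro k hk
        have hpos : 0 ≤ Real.logb 2 (p k / q k) := Real.logb_nonneg (by norm_num)
          ((one_le_div (hq0 k)).2 (hqp k (Finset.mem_Iic.1 hk)))
        have h2 : ∑ t ∈ fib k, Real.logb 2 (p' t / q' t) =
            ∑ t ∈ fib k, Real.logb 2 (p k / q k) := by
          refine Finset.sum_congr rfl fun t ht => ?_
          simp only [fib, Finset.mem_filter_univ] at ht
          have h3 := (hp'.1 t).ne'
          have h4 := (hp.1 k).ne'
          have h5 := (hq0 k).ne'
          rw [hq']; simp only [ht]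
          congr 1
          field_simp
        rw [h2, Finset.sum_const, nsmul_eq_mul]
        exact mul_le_mul_of_nonneg_right (hfib_card k) hpos
      calc 1 / (2 * (m : ℝ)) * ∑ k ∈ Finset.Iic k₀, ∑ t ∈ fib k, Real.logb 2 (p' t / q' t)
          ≤ 1 / (2 * (m : ℝ)) * ∑ k ∈ Finset.Iic k₀, m / K * F * Real.logb 2 (p k / q k) := by
            gcongr with k hk
            exact h1 k hk
        _ = _ := by rw [← Finset.mul_sum]; field_simp
  have h1 : ⨅ a : feasibleAttacks m P N p', objective m p' a ≤
      F * ⨅ a : feasibleAttacks K P N p, objective K p a := by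
    obtain ⟨a₀, ha₀, -⟩ := exists_feasibleAttack hK hP hN hp
    have : Nonempty (feasibleAttacks K P N p) := ⟨⟨a₀, ha₀⟩⟩
    rw [← div_le_iff₀' hF0]
    refine le_ciInf fun ⟨a, ha⟩ => ?_
    obtain ⟨a', ha', hle⟩ := key a ha
    rw [div_le_iff₀' hF0]
    exact (iInf_objective_le ha').trans hle
  exact h1.trans (mul_le_mul_of_nonneg_left (iInf_objective_le_optimalValue hK hP hN hp) hF0.le)

/-- A uniform subdivision of every position into `J` parts: no attack on the subdivision, at any
division point and even with slightly too much noise energy, gets much below a lower bound for the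
attacks on the original allocation. -/
lemma le_prefix_rate_of_pushable {K J : ℕ} (hJ : 0 < J) {P N c η δ : ℝ} {p : Fin K → ℝ}
    (hp : p ∈ signalPowerSet K P) (hc : ∀ a ∈ feasibleAttacks K P N p, c ≤ objective K p a)
    (hK : 0 < K) (hη0 : 0 < η) (hη : η ≤ 1 / 2) (hδN : δ ≤ η * N) (hδ0 : 0 ≤ δ)
    (hδp : ∀ k, 2 * K * δ ≤ p k) {u : Fin (K * J) → ℝ} (hu0 : ∀ j, 0 < u j) (hu1 : ∀ j, u j ≤ 1)
    {i : ℕ}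
    (hA : ∑ j : Fin (K * J), (if (j : ℕ) < i then p j.divNat * u j else 0) ≤ K * J * (N + δ))
    (hS : ∑ j : Fin (K * J), (if (j : ℕ) < i then 0 else p j.divNat) ≤
      2 * (K * J * N - ∑ j : Fin (K * J), if (j : ℕ) < i then p j.divNat * u j else 0) +
        K * J * δ) :
    c ≤ 1 / (2 * (K * J)) *
      ∑ j : Fin (K * J), (if (j : ℕ) < i then -Real.logb 2 (u j) else 0) +
        1 / 2 * -Real.logb 2 (1 - η) + 2 / K := by
  have hK' : (0 : ℝ) < K := by positivity
  have hJ' : (0 : ℝ) < J := by positivity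
  have hsum : ∀ f : Fin (K * J) → ℝ, ∑ j, f j = ∑ k, ∑ b, f (finProdFinEquiv (k, b)) := fun f => by
    rw [← Equiv.sum_comp finProdFinEquiv, Fintype.sum_prod_type]
  have hdiv : ∀ (k : Fin K) (b : Fin J), (finProdFinEquiv (k, b)).divNat = k := fun k b =>
    congrArg Prod.fst (finProdFinEquiv.symm_apply_apply (k, b))
  set A := ∑ j : Fin (K * J), (if (j : ℕ) < i then p j.divNat * u j else 0) with hAdef
  set S := ∑ j : Fin (K * J), (if (j : ℕ) < i then 0 else p j.divNat) with hSdef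
  -- Shrinking the prefix noise by `1 - η` makes up for the excess energy. At ratio `1 / 4` a part
  -- of signal energy `s` behind the prefix lowers the left side of the pushing constraint by `s`
  -- and the right side by `s / 2` only, so extending the prefix gains `s / 2`.
  set u' : Fin (K * J) → ℝ := fun j => if (j : ℕ) < i then (1 - η) * u j else 1 / 4 with hu'
  have hu'0 : ∀ j, 0 < u' j := fun j => by
    simp only [hu']; split_ifs
    · exact mul_pos (by linarith) (hu0 j)
    · norm_num
  have hu'1 : ∀ j, u' j ≤ 1 := fun j => by
    simp only [hu']; split_ifs
    · nlinarith [hu0 j, hu1 j]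
    · norm_num
  set v : Fin K → ℝ := fun k => ∑ b, (1 / J : ℝ) * u' (finProdFinEquiv (k, b)) with hv
  have hw : ∑ _b : Fin J, (1 / J : ℝ) = 1 := by simp [hJ'.ne']
  have hv0 : ∀ k, 0 < v k := fun k =>
    Finset.sum_pos (fun b _ => mul_pos (by positivity) (hu'0 _)) ⟨⟨0, hJ⟩, Finset.mem_univ _⟩
  have hv1 : ∀ k, v k ≤ 1 := fun k => by
    rw [← hw]
    exact Finset.sum_le_sum fun b _ => mul_le_of_le_one_right (by positivity) (hu'1 _)
  -- Jensen's inequality: averaging the ratios within a position can only help the adversary.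
  have hvlog : ∀ k, -Real.logb 2 (v k) ≤
      ∑ b, (1 / J : ℝ) * -Real.logb 2 (u' (finProdFinEquiv (k, b))) := by
    intro k
    have h := strictConcaveOn_log_Ioi.concaveOn.le_map_sum (t := Finset.univ)
      (w := fun _ : Fin J => (1 / J : ℝ)) (p := fun b => u' (finProdFinEquiv (k, b)))
      (fun b _ => by positivity) hw (fun b _ => hu'0 _)
    simp only [smul_eq_mul] at h
    have h2 : (0 : ℝ) < Real.log 2 := Real.log_pos (by norm_num)
    simp only [Real.logb, ← neg_div, mul_div_assoc']
    rw [← Finset.sum_div, div_le_div_iff_of_pos_right h2]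
    simp only [mul_neg, Finset.sum_neg_distrib]
    linarith
  -- The prefix is extended through the position containing `i` and through the whole next one,
  -- which guarantees a gain of at least `J * p m / 2`, enough for the slack `K * J * δ`. If there
  -- is no next position, the prefix is everything and the constraint is the total energy bound.
  set m : Fin K := ⟨min (i / J + 1) (K - 1), by omega⟩ with hm
  have hmi : (m : ℕ) * J ≤ i + J := by
    have h1 : (m : ℕ) ≤ i / J + 1 := min_le_left _ _
    have h2 := Nat.div_mul_le_self i J
    nlinarith
  have hval : ∀ (k : Fin K) (b : Fin J), ((finProdFinEquiv (k, b) : Fin (K * J)) : ℕ) = b + J * k :=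
    fun k b => rfl
  have hpre : ∀ f : Fin (K * J) → ℝ, ∑ j, (if j.divNat ≤ m then f j else 0) =
      ∑ k ∈ Finset.Iic m, ∑ b, f (finProdFinEquiv (k, b)) := by
    intro f
    rw [hsum, ← Finset.sum_filter_add_sum_filter_not Finset.univ (fun k => k ≤ m)]
    simp only [hdiv]
    rw [Finset.sum_congr rfl (fun k hk => Finset.sum_congr rfl fun b _ =>
      if_pos (Finset.mem_filter.1 hk).2)]
    rw [Finset.sum_congr (s₁ := Finset.univ.filter fun k => ¬ k ≤ m) rfl
      (fun k hk => Finset.sum_congr rfl fun b _ => if_neg (Finset.mem_filter.1 hk).2)]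
    simp only [Finset.sum_const_zero, add_zero]
    refine Finset.sum_congr ?_ fun _ _ => rfl
    ext k; simp
  have hvsum : ∀ k, p k * v k = 1 / J * ∑ b, p k * u' (finProdFinEquiv (k, b)) := fun k => by
    rw [hv, Finset.mul_sum, Finset.mul_sum]
    exact Finset.sum_congr rfl fun b _ => by ring
  have hpu' : ∀ j, p j.divNat * u' j = (1 - η) * (if (j : ℕ) < i then p j.divNat * u j else 0) +
      1 / 4 * (if (j : ℕ) < i then 0 else p j.divNat) := fun j => by
    simp only [hu']; split_ifs <;> ring
  have htot : ∑ k, p k * v k ≤ K * N := by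
    have h1 : ∑ k, p k * v k = 1 / J * ∑ j, p j.divNat * u' j := by
      rw [hsum, Finset.mul_sum]
      simp only [hvsum, hdiv]
    simp only [hpu', Finset.sum_add_distrib, ← Finset.mul_sum, ← hAdef, ← hSdef] at h1
    rw [h1, one_div, inv_mul_le_iff₀ hJ']
    have h2 : (1 / 2 - η) * A ≤ (1 / 2 - η) * (K * J * (N + δ)) :=
      mul_le_mul_of_nonneg_left hA (by linarith)
    have h3 : (K * J : ℝ) * δ ≤ K * J * (η * N) := by gcongr
    have h4 : 0 ≤ (K * J : ℝ) * δ * η := by positivity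
    nlinarith
  have hfeas : ((fun k => p k * v k), m) ∈ feasibleAttacks K P N p := by
    refine ⟨⟨fun k => mul_pos (hp.1 k) (hv0 k), htot⟩,
      fun k _ => mul_le_of_le_one_right (hp.1 k).le (hv1 k), ?_⟩
    simp only
    by_cases hcase : i / J + 1 ≤ K - 1
    swap
    · have huniv : Finset.Iic m = Finset.univ := by
        ext k
        simp only [Finset.mem_Iic, Finset.mem_univ, iff_true, Fin.le_def, hm]
        omega
      rw [huniv, hp.2, ← Finset.mul_sum]
      linarith
    have hmv : (m : ℕ) = i / J + 1 := min_eq_left hcase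
    have hlt : i < m * J := by
      rw [hmv, mul_comm]; exact Nat.lt_mul_div_succ i hJ
    have hle : ∀ j : Fin (K * J), (j : ℕ) < i → j.divNat ≤ m := by
      intro j hj
      rw [Fin.le_def, hmv]
      exact (Nat.div_le_div_right hj.le).trans (Nat.le_succ _)
    set B := ∑ j : Fin (K * J),
      (if j.divNat ≤ m then (if (j : ℕ) < i then 0 else p j.divNat) else 0) with hB
    have hBm : J * p m ≤ B := by
      rw [hB, hpre]
      have h1 : ∑ b : Fin J, (if ((finProdFinEquiv (m, b) : Fin (K * J)) : ℕ) < i then 0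
          else p (finProdFinEquiv (m, b)).divNat) = J * p m := by
        have h2 : ∀ b : Fin J, ¬ ((finProdFinEquiv (m, b) : Fin (K * J)) : ℕ) < i := by
          intro b
          rw [hval, mul_comm J]; omega
        simp only [h2, if_false, hdiv]
        simp
      rw [← h1]
      refine Finset.single_le_sum (f := fun k => ∑ b : Fin J,
        (if ((finProdFinEquiv (k, b) : Fin (K * J)) : ℕ) < i then 0
          else p (finProdFinEquiv (k, b)).divNat)) (fun k _ => Finset.sum_nonneg fun b _ => ?_)
        (Finset.mem_Iic.2 le_rfl)
      split_ifs
      · exact le_rfl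
      · exact (hp.1 _).le
    have hpsum : (J : ℝ) * (K * P - ∑ k ∈ Finset.Iic m, p k) = S - B := by
      have h1 : ∑ j : Fin (K * J), p j.divNat = J * (K * P) := by
        rw [hsum]; simp only [hdiv]; simp [← Finset.mul_sum, hp.2]
      have h2 : ∑ j : Fin (K * J), (if j.divNat ≤ m then p j.divNat else 0) =
          J * ∑ k ∈ Finset.Iic m, p k := by
        rw [hpre]; simp only [hdiv]; simp [← Finset.mul_sum]
      have h3 : ∑ j : Fin (K * J), p j.divNat - ∑ j : Fin (K * J),
          (if j.divNat ≤ m then p j.divNat else 0) = S - B := by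
        rw [hSdef, hB, ← Finset.sum_sub_distrib, ← Finset.sum_sub_distrib]
        refine Finset.sum_congr rfl fun j _ => ?_
        by_cases hj : (j : ℕ) < i
        · simp [hj, hle j hj]
        · simp [hj]
      rw [← h3, h1, h2]; ring
    have hNsum : (J : ℝ) * ∑ k ∈ Finset.Iic m, p k * v k = (1 - η) * A + 1 / 4 * B := by
      have h1 : (J : ℝ) * ∑ k ∈ Finset.Iic m, p k * v k =
          ∑ j : Fin (K * J), (if j.divNat ≤ m then p j.divNat * u' j else 0) := by
        rw [hpre, Finset.mul_sum]
        refine Finset.sum_congr rfl fun k _ => ?_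
        rw [hvsum]
        simp only [hdiv]
        field_simp
      rw [h1, hAdef, hB, Finset.mul_sum, Finset.mul_sum, ← Finset.sum_add_distrib]
      refine Finset.sum_congr rfl fun j _ => ?_
      rw [hpu']
      by_cases hj : (j : ℕ) < i
      · simp [hj, hle j hj]
      · simp [hj]
    have hA0 : 0 ≤ A := Finset.sum_nonneg fun j _ => by
      split_ifs
      · exact mul_nonneg (hp.1 _).le (hu0 j).le
      · exact le_rfl
    have h5 : (J : ℝ) * (2 * K * δ) ≤ J * p m := by gcongr; exact hδp m
    have h6 : 0 ≤ η * A := by positivity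
    refine le_of_mul_le_mul_left ?_ hJ'
    rw [hpsum, ← Finset.mul_sum]
    have : (J : ℝ) * (2 * (K * N) - 2 * ∑ k ∈ Finset.Iic m, p k * v k) =
      2 * (K * J * N) - 2 * (J * ∑ k ∈ Finset.Iic m, p k * v k) := by ring
    rw [this, hNsum]
    nlinarith
  refine (hc _ hfeas).trans ?_
  have hlη : 0 ≤ -Real.logb 2 (1 - η) :=
    neg_nonneg.2 (Real.logb_nonpos (by norm_num) (by linarith) (by linarith))
  have hl4 : Real.logb 2 (1 / 4) = -2 := by
    rw [show (1 / 4 : ℝ) = 2 ^ (-2 : ℝ) by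
      rw [Real.rpow_neg (by norm_num)]; norm_num, Real.logb_rpow (by norm_num) (by norm_num)]
  -- The extension adds at most `2 * J` parts at `log₂ 4 = 2` bits each, which becomes `2 / K` after
  -- normalization.
  have hterm : ∀ j : Fin (K * J), (if j.divNat ≤ m then -Real.logb 2 (u' j) else 0) ≤
      (if (j : ℕ) < i then -Real.logb 2 (u j) else 0) + -Real.logb 2 (1 - η) +
        (if i ≤ j ∧ (j : ℕ) < i + 2 * J then 2 else 0) := by
    intro j
    by_cases hj : (j : ℕ) < i
    · have h1 : ¬ (i ≤ j ∧ (j : ℕ) < i + 2 * J) := by omega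
      have h2 : Real.logb 2 (u' j) = Real.logb 2 (1 - η) + Real.logb 2 (u j) := by
        simp only [hu', hj, if_true]
        exact Real.logb_mul (by linarith) (hu0 j).ne'
      have h3 : 0 ≤ -Real.logb 2 (u j) :=
        neg_nonneg.2 (Real.logb_nonpos (by norm_num) (hu0 j).le (hu1 j))
      simp only [hj, h1, if_true, if_false]
      split_ifs
      · linarith
      · linarith
    · simp only [hj, if_false, hu', hl4]
      by_cases hjm : j.divNat ≤ m
      · have h1 : (j : ℕ) < (m + 1) * J := by
          have h2 : (j : ℕ) / J ≤ m := hjm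
          have h3 := Nat.lt_mul_div_succ (j : ℕ) hJ
          nlinarith
        have h4 : i ≤ j ∧ (j : ℕ) < i + 2 * J := ⟨by omega, by nlinarith⟩
        simp only [hjm, h4, if_true, and_self]
        linarith
      · simp only [hjm, if_false]
        split_ifs <;> linarith
  have hobj : objective K p ((fun k => p k * v k), m) ≤ 1 / (2 * (K * J)) *
      ∑ j : Fin (K * J), (if j.divNat ≤ m then -Real.logb 2 (u' j) else 0) := by
    rw [hpre]
    have h1 : ∀ k, Real.logb 2 (p k / (p k * v k)) ≤
        1 / J * ∑ b, -Real.logb 2 (u' (finProdFinEquiv (k, b))) := by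
      intro k
      have h2 : p k / (p k * v k) = (v k)⁻¹ := by
        have := (hp.1 k).ne'
        field_simp
      rw [h2, Real.logb_inv, Finset.mul_sum]
      exact hvlog k
    calc objective K p ((fun k => p k * v k), m)
        ≤ 1 / (2 * K) * ∑ k ∈ Finset.Iic m,
            1 / J * ∑ b, -Real.logb 2 (u' (finProdFinEquiv (k, b))) := by
          unfold objective
          gcongr with k hk
          exact h1 k
      _ = _ := by rw [← Finset.mul_sum]; field_simp
  refine hobj.trans ?_
  have hcount : ∑ j : Fin (K * J), (if i ≤ j ∧ (j : ℕ) < i + 2 * J then (2 : ℝ) else 0) ≤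
      2 * (2 * J) := by
    rw [← Finset.sum_filter, Finset.sum_const, nsmul_eq_mul]
    have : (Finset.univ.filter fun j : Fin (K * J) => i ≤ j ∧ (j : ℕ) < i + 2 * J).card ≤
        2 * J := by
      have := Finset.card_le_card_of_injOn (t := Finset.Ico i (i + 2 * J))
        (s := Finset.univ.filter fun j : Fin (K * J) => i ≤ j ∧ (j : ℕ) < i + 2 * J)
        (fun j : Fin (K * J) => (j : ℕ)) (fun j hj => by simpa using hj)
        (fun a _ b _ h => Fin.ext h)
      simpa using this
    have h2 : ((Finset.univ.filter fun j : Fin (K * J) => i ≤ j ∧ (j : ℕ) < i + 2 * J).card : ℝ) ≤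
        2 * J := by exact_mod_cast this
    linarith
  have hfin := Finset.sum_le_sum fun j (_ : j ∈ Finset.univ) => hterm j
  rw [Finset.sum_add_distrib, Finset.sum_add_distrib, Finset.sum_const, Finset.card_univ,
    Fintype.card_fin, nsmul_eq_mul] at hfin
  push_cast at hfin
  calc _ ≤ 1 / (2 * ((K : ℝ) * J)) *
        (∑ j : Fin (K * J), (if (j : ℕ) < i then -Real.logb 2 (u j) else 0) +
          K * J * -Real.logb 2 (1 - η) + 2 * (2 * J)) := by
        gcongr
        linarith
    _ = _ := by field_simp

end Optimization

/-! ### The decoder -/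

section Decoder

/-- The number of blocks after which the prefix with noise indices `q` is list decodable. -/
noncomputable def decodingIndex {I : ℕ} (δ Θ : ℝ) (q : Fin I → ℕ) : ℕ :=
  sInf {i | Θ < prefixRate δ q i}

/-- The noise indices `q` respect the total energy budget `B`. -/
def IsAdmissible {I : ℕ} (δ : ℝ) (pw : Fin I → ℝ) (B : ℝ) (q : Fin I → ℕ) : Prop :=
  ∑ j, pw j * (δ * q j) ≤ B

open Classical in
/-- The decoder: given the table of noise indices of all codewords, it selects an admissible
hypothesis that becomes list decodable as early as possible. -/
noncomputable def decode {M I G : ℕ} (δ Θ : ℝ) (pw : Fin I → ℝ) (B : ℝ) (w₀ : Fin M)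
    (Q : Fin M → Fin I → Fin G → ℕ) : Fin M :=
  if h : ∃ h : Fin M × (Fin I → Fin G), IsAdmissible δ pw B (fun j => Q h.1 j (h.2 j)) ∧
      ∀ h' : Fin M × (Fin I → Fin G), IsAdmissible δ pw B (fun j => Q h'.1 j (h'.2 j)) →
        decodingIndex δ Θ (fun j => Q h.1 j (h.2 j)) ≤
          decodingIndex δ Θ (fun j => Q h'.1 j (h'.2 j))
  then h.choose.1 else w₀

lemma exists_decode_eq {M I G : ℕ} {δ Θ : ℝ} {pw : Fin I → ℝ} {B : ℝ} (w₀ : Fin M)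
    (Q : Fin M → Fin I → Fin G → ℕ) {w : Fin M} {κ : Fin I → Fin G}
    (hw : IsAdmissible δ pw B fun j => Q w j (κ j)) :
    ∃ κ' : Fin I → Fin G,
      IsAdmissible δ pw B (fun j => Q (decode δ Θ pw B w₀ Q) j (κ' j)) ∧
      decodingIndex δ Θ (fun j => Q (decode δ Θ pw B w₀ Q) j (κ' j)) ≤
        decodingIndex δ Θ (fun j => Q w j (κ j)) := by
  classical
  have h : ∃ h : Fin M × (Fin I → Fin G), IsAdmissible δ pw B (fun j => Q h.1 j (h.2 j)) ∧
      ∀ h' : Fin M × (Fin I → Fin G), IsAdmissible δ pw B (fun j => Q h'.1 j (h'.2 j)) →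
        decodingIndex δ Θ (fun j => Q h.1 j (h.2 j)) ≤
          decodingIndex δ Θ (fun j => Q h'.1 j (h'.2 j)) := by
    obtain ⟨x, hx, hmin⟩ := Finset.exists_min_image
      (Finset.univ.filter fun h : Fin M × (Fin I → Fin G) =>
        IsAdmissible δ pw B (fun j => Q h.1 j (h.2 j)))
      (fun h => decodingIndex δ Θ (fun j => Q h.1 j (h.2 j))) ⟨(w, κ), by simpa using hw⟩
    refine ⟨x, by simpa using hx, fun h' hh' => hmin h' (by simpa using hh')⟩
  rw [decode, dif_pos h]
  exact ⟨h.choose.2, h.choose_spec.1, h.choose_spec.2 (w, κ) hw⟩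

/-- The part of a sum over the blocks from the `i`-th on. -/
def suffixSum {I : ℕ} (i : ℕ) (f : Fin I → ℝ) : ℝ :=
  ∑ j ∈ Finset.univ.filter (fun j : Fin I => ¬ (j : ℕ) < i), f j

/-- The part of a sum over the first `i` blocks. -/
def prefixSum {I : ℕ} (i : ℕ) (f : Fin I → ℝ) : ℝ :=
  ∑ j ∈ Finset.univ.filter (fun j : Fin I => (j : ℕ) < i), f j

lemma prefixSum_add_suffixSum {I : ℕ} (i : ℕ) (f : Fin I → ℝ) :
    prefixSum i f + suffixSum i f = ∑ j, f j :=
  Finset.sum_filter_add_sum_filter_not _ _ _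

lemma suffixSum_mono {I : ℕ} (i : ℕ) {f g : Fin I → ℝ} (h : ∀ j : Fin I, i ≤ j → f j ≤ g j) :
    suffixSum i f ≤ suffixSum i g :=
  Finset.sum_le_sum fun j hj => h j (by simpa using hj)

lemma suffixSum_le_sum {I : ℕ} (i : ℕ) {f : Fin I → ℝ} (h : ∀ j, 0 ≤ f j) :
    suffixSum i f ≤ ∑ j, f j :=
  Finset.sum_le_sum_of_subset_of_nonneg (Finset.filter_subset _ _) fun j _ _ => h j

lemma prefixSum_mono_index {I : ℕ} {i i' : ℕ} (hi : i ≤ i') {f : Fin I → ℝ} (h : ∀ j, 0 ≤ f j) :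
    prefixSum i f ≤ prefixSum i' f := by
  refine Finset.sum_le_sum_of_subset_of_nonneg ?_ fun j _ _ => h j
  intro j hj
  simp only [Finset.mem_filter_univ] at hj ⊢
  omega

lemma suffixSum_le_add {I : ℕ} (i : ℕ) {f : Fin I → ℝ} {σ : ℝ} (hσ : 0 ≤ σ) (h : ∀ j, f j ≤ σ) :
    suffixSum i f ≤ suffixSum (i + 1) f + σ := by
  classical
  by_cases hi : i < I
  · have : Finset.univ.filter (fun j : Fin I => ¬ (j : ℕ) < i) =
        insert ⟨i, hi⟩ (Finset.univ.filter (fun j : Fin I => ¬ (j : ℕ) < i + 1)) := by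
      ext j
      simp only [Finset.mem_filter_univ, Finset.mem_insert, Fin.ext_iff]
      omega
    rw [suffixSum, this, Finset.sum_insert (by simp), suffixSum, add_comm]
    gcongr
    exact h _
  · have h0 : ∀ i', I ≤ i' → suffixSum i' f = 0 := fun i' hi' => by
      rw [suffixSum, Finset.filter_false_of_mem fun j _ => by have := j.2; omega]
      simp
    rw [h0 i (by omega), h0 (i + 1) (by omega)]
    simpa using hσ

/-- The adversary cannot push an undecodable prefix. -/
def NotPushable {I : ℕ} (δ Θ : ℝ) (pw : Fin I → ℝ) (B slack : ℝ) : Prop :=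
  ∀ q : Fin I → ℕ, IsAdmissible δ pw B q → ∀ i, prefixRate δ q i ≤ Θ →
    2 * (B - prefixSum i fun j => pw j * (δ * q j)) + slack < suffixSum i pw

variable {M I G : ℕ} {δ Θ B slack σ τ : ℝ} {pw : Fin I → ℝ}

/-- Otherwise the full block would be undecodable, and an empty suffix would have positive energy.
-/
lemma NotPushable.exists_lt (h : NotPushable δ Θ pw B slack) (hs : 0 ≤ slack) {q : Fin I → ℕ}
    (hq : IsAdmissible δ pw B q) : ∃ i, Θ < prefixRate δ q i := by
  by_contra! hcon
  have h1 := h q hq I (hcon I)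
  have h2 : suffixSum I pw = 0 := by
    rw [suffixSum, Finset.filter_false_of_mem fun j _ => by have := j.2; omega]
    simp
  have h3 : (prefixSum I fun j => pw j * (δ * q j)) = ∑ j, pw j * (δ * q j) := by
    rw [prefixSum, Finset.filter_true_of_mem fun j _ => j.2]
  rw [h2, h3] at h1
  have : ∑ j, pw j * (δ * q j) ≤ B := hq
  linarith

/-- The prefix of `i - 1` blocks is not yet decodable. Passing from `i - 1` to `i` removes one block
from the suffix, of power at most `σ`. -/
lemma NotPushable.lt_suffixSum (h : NotPushable δ Θ pw B slack) (hδ : 0 < δ) (hpw : ∀ j, 0 ≤ pw j)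
    (hσ0 : 0 ≤ σ) (hσ : ∀ j, pw j ≤ σ) {q : Fin I → ℕ} (hq : IsAdmissible δ pw B q) {i : ℕ}
    (hi : 1 ≤ i) (hle : i ≤ decodingIndex δ Θ q) :
    2 * (B - prefixSum i fun j => pw j * (δ * q j)) + slack - σ < suffixSum i pw := by
  obtain ⟨i, rfl⟩ : ∃ i', i = i' + 1 := ⟨i - 1, by omega⟩
  have h1 : prefixRate δ q i ≤ Θ := by
    by_contra! hcon
    have : decodingIndex δ Θ q ≤ i := Nat.sInf_le hcon
    omega
  have h2 := h q hq i h1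
  have h3 := suffixSum_le_add i hσ0 hσ
  have h4 := prefixSum_mono_index (Nat.le_succ i)
    (f := fun j => pw j * (δ * q j)) fun j => mul_nonneg (hpw j) (by positivity)
  rw [Nat.succ_eq_add_one] at h4
  linarith

lemma suffixSum_sq_norm_sub_le {E : Type*} [NormedAddCommGroup E] (hδ : 0 < δ)
    (hpw : ∀ j, 0 ≤ pw j) (y x : Fin I → E)
    (hq : IsAdmissible δ pw B fun j => noiseIndex δ (y j) (x j)) (i : ℕ) :
    suffixSum i (fun j => pw j * ‖y j - x j‖ ^ 2) ≤
      B - prefixSum i (fun j => pw j * (δ * noiseIndex δ (y j) (x j))) + δ * ∑ j, pw j := by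
  have h1 : suffixSum i (fun j => pw j * ‖y j - x j‖ ^ 2) ≤
      suffixSum i (fun j => pw j * (δ * noiseIndex δ (y j) (x j))) + δ * suffixSum i pw := by
    rw [suffixSum, suffixSum, suffixSum, Finset.mul_sum, ← Finset.sum_add_distrib]
    refine Finset.sum_le_sum fun j _ => ?_
    have := mul_le_mul_of_nonneg_left (sq_norm_sub_le hδ (y j) (x j)) (hpw j)
    linarith
  have h2 := prefixSum_add_suffixSum i fun j => pw j * (δ * noiseIndex δ (y j) (x j))
  have h3 : ∑ j, pw j * (δ * noiseIndex δ (y j) (x j)) ≤ B := hq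
  have h4 := mul_le_mul_of_nonneg_left (suffixSum_le_sum i hpw) hδ.le
  linarith

/-- The decoder is correct unless, in some block, the key of the transmitter is bad with respect to
a message that is listed after an earlier block. -/
theorem decode_eq {E : Type*} [NormedAddCommGroup E] [InnerProductSpace ℝ E]
    (hnp : NotPushable δ Θ pw B slack) (hδ : 0 < δ) (hΘ : 0 ≤ Θ) (hpw : ∀ j, 0 ≤ pw j)
    (hσ0 : 0 ≤ σ) (hσ : ∀ j, pw j ≤ σ) (hτ0 : 0 ≤ τ) (hτ1 : τ ≤ 1)
    (hslack : (3 * τ + 2 * δ) * ∑ j, pw j + σ ≤ slack)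
    {z : Fin M → Fin I → Fin G → E} (hz : ∀ w j k, 1 - τ ≤ ‖z w j k‖) (w₀ : Fin M)
    {y : Fin I → E} {w : Fin M} {κ : Fin I → Fin G}
    (hw : IsAdmissible δ pw B fun j => noiseIndex δ (y j) (z w j (κ j)))
    (hgood : ∀ (i : ℕ) (j : Fin I), i ≤ j → ∀ w', w ≠ w' →
      (∃ κ' : Fin I → Fin G, Θ < prefixRate δ (fun j => noiseIndex δ (y j) (z w' j (κ' j))) i) →
      ∀ k', inner ℝ (z w j (κ j)) (z w' j k') ≤ τ) :
    decode δ Θ pw B w₀ (fun w j k => noiseIndex δ (y j) (z w j k)) = w := by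
  obtain ⟨κ', hadm, hle⟩ := exists_decode_eq (Θ := Θ) w₀
    (fun w j k => noiseIndex δ (y j) (z w j k)) hw
  set w' := decode δ Θ pw B w₀ (fun w j k => noiseIndex δ (y j) (z w j k)) with hw'
  by_contra hne
  have hW : 0 ≤ ∑ j, pw j := Finset.sum_nonneg fun j _ => hpw j
  have hslack0 : 0 ≤ slack := le_trans (by positivity) hslack
  set i := decodingIndex δ Θ (fun j => noiseIndex δ (y j) (z w' j (κ' j))) with hi
  have hrate : Θ < prefixRate δ (fun j => noiseIndex δ (y j) (z w' j (κ' j))) i :=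
    -- Nonemptiness matters here: otherwise the decoding index would be the default value `0`.
    Nat.sInf_mem (hnp.exists_lt hslack0 hadm)
  have hi1 : 1 ≤ i := by
    by_contra! h0
    have h0' : i = 0 := by omega
    rw [h0'] at hrate
    simp only [prefixRate, Nat.not_lt_zero, Finset.filter_false, Finset.sum_empty] at hrate
    linarith
  have h1 := hnp.lt_suffixSum hδ hpw hσ0 hσ hadm hi1 le_rfl
  have h2 := hnp.lt_suffixSum hδ hpw hσ0 hσ hw hi1 hle
  have h3 := suffixSum_sq_norm_sub_le hδ hpw y (fun j => z w' j (κ' j)) hadm i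
  have h4 := suffixSum_sq_norm_sub_le hδ hpw y (fun j => z w j (κ j)) hw i
  have h5 : suffixSum i (fun j => pw j * (2 - 6 * τ)) ≤
      suffixSum i (fun j => 2 * (pw j * ‖y j - z w j (κ j)‖ ^ 2) +
        2 * (pw j * ‖y j - z w' j (κ' j)‖ ^ 2)) := by
    refine suffixSum_mono i fun j hj => ?_
    have hin := hgood i j hj w' (Ne.symm hne) ⟨κ', hrate⟩ (κ' j)
    have hn1 := hz w j (κ j)
    have hn2 := hz w' j (κ' j)
    have hsub := norm_sub_sq_real (z w j (κ j)) (z w' j (κ' j))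
    -- Nearly orthogonal codewords have squared distance at least `2 * (1 - τ) ^ 2 - 2 * τ ≥ 2 - 6 *
    -- τ`, so the two squared noise norms sum to at least half of that.
    have hpar := parallelogram_law_with_norm ℝ (y j - z w j (κ j)) (y j - z w' j (κ' j))
    have heq : (y j - z w j (κ j)) - (y j - z w' j (κ' j)) =
        -(z w j (κ j) - z w' j (κ' j)) := by abel
    rw [heq, norm_neg] at hpar
    have hlow : 2 - 6 * τ ≤ ‖z w j (κ j) - z w' j (κ' j)‖ ^ 2 := by
      rw [hsub]
      have e1 : (1 - τ) ^ 2 ≤ ‖z w j (κ j)‖ ^ 2 := pow_le_pow_left₀ (by linarith) hn1 2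
      have e2 : (1 - τ) ^ 2 ≤ ‖z w' j (κ' j)‖ ^ 2 := pow_le_pow_left₀ (by linarith) hn2 2
      nlinarith
    have hup : 2 - 6 * τ ≤ 2 * ‖y j - z w j (κ j)‖ ^ 2 + 2 * ‖y j - z w' j (κ' j)‖ ^ 2 := by
      nlinarith [mul_self_nonneg ‖y j - z w j (κ j) + (y j - z w' j (κ' j))‖]
    nlinarith [mul_le_mul_of_nonneg_left hup (hpw j)]
  have h6 : suffixSum i (fun j => pw j * (2 - 6 * τ)) = suffixSum i pw * (2 - 6 * τ) := by
    rw [suffixSum, suffixSum, Finset.sum_mul]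
  have h7 : suffixSum i (fun j => 2 * (pw j * ‖y j - z w j (κ j)‖ ^ 2) +
        2 * (pw j * ‖y j - z w' j (κ' j)‖ ^ 2)) =
      2 * suffixSum i (fun j => pw j * ‖y j - z w j (κ j)‖ ^ 2) +
        2 * suffixSum i (fun j => pw j * ‖y j - z w' j (κ' j)‖ ^ 2) := by
    simp only [suffixSum, Finset.sum_add_distrib, Finset.mul_sum]
  rw [h6, h7] at h5
  have h8 := mul_le_mul_of_nonneg_left (suffixSum_le_sum i hpw) hτ0
  linarith

end Decoder

/-! ### Blocks of coordinates -/

section Blocks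

variable {I l n : ℕ}

/-- The position of the `b`-th coordinate of the `j`-th block of length `l`. -/
def blockIndex (h : I * l ≤ n) (q : Fin I × Fin l) : Fin n := Fin.castLE h (finProdFinEquiv q)

lemma blockIndex_val (h : I * l ≤ n) (j : Fin I) (b : Fin l) :
    (blockIndex h (j, b) : ℕ) = b + l * j := rfl

lemma blockIndex_injective (h : I * l ≤ n) : Function.Injective (blockIndex h) :=
  (Fin.castLE_injective h).comp finProdFinEquiv.injective

/-- The `j`-th block of a sequence, scaled by an amplitude. -/
noncomputable def blockVec (h : I * l ≤ n) (amp : Fin I → ℝ) (y : Fin n → ℝ) (j : Fin I) :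
    EuclideanSpace ℝ (Fin l) :=
  WithLp.toLp 2 fun b => y (blockIndex h (j, b)) / amp j

/-- The sequence with given scaled blocks, followed by zeros. -/
noncomputable def assemble (n : ℕ) (amp : Fin I → ℝ) (v : Fin I → EuclideanSpace ℝ (Fin l)) :
    Fin n → ℝ := fun t =>
  if ht : (t : ℕ) < I * l then
    amp (finProdFinEquiv.symm ⟨t, ht⟩).1 *
      v (finProdFinEquiv.symm ⟨t, ht⟩).1 (finProdFinEquiv.symm ⟨t, ht⟩).2
  else 0

lemma assemble_blockIndex (h : I * l ≤ n) (amp : Fin I → ℝ)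
    (v : Fin I → EuclideanSpace ℝ (Fin l)) (q : Fin I × Fin l) :
    assemble n amp v (blockIndex h q) = amp q.1 * v q.1 q.2 := by
  have hq : ((blockIndex h q : Fin n) : ℕ) < I * l := (finProdFinEquiv q).2
  have h2 : (⟨(blockIndex h q : Fin n), hq⟩ : Fin (I * l)) = finProdFinEquiv q := rfl
  rw [assemble, dif_pos hq, h2, Equiv.symm_apply_apply]

lemma exists_blockIndex_eq (h : I * l ≤ n) {t : Fin n} (ht : (t : ℕ) < I * l) :
    ∃ q, blockIndex h q = t :=
  ⟨finProdFinEquiv.symm ⟨t, ht⟩, by rw [blockIndex, Equiv.apply_symm_apply]; rfl⟩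

lemma blockVec_add_assemble (h : I * l ≤ n) {amp : Fin I → ℝ} (hamp : ∀ j, amp j ≠ 0)
    (v : Fin I → EuclideanSpace ℝ (Fin l)) (s : Fin n → ℝ) (j : Fin I) :
    blockVec h amp (assemble n amp v + s) j = v j + blockVec h amp s j := by
  ext b
  simp only [blockVec, Pi.add_apply, assemble_blockIndex, PiLp.add_apply]
  have := hamp j
  field_simp

lemma sum_sq_assemble (h : I * l ≤ n) (amp : Fin I → ℝ) (v : Fin I → EuclideanSpace ℝ (Fin l)) :
    ∑ t, assemble n amp v t ^ 2 = ∑ j, amp j ^ 2 * ‖v j‖ ^ 2 := by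
  rw [← Fintype.sum_of_injective (blockIndex h) (blockIndex_injective h)
    (fun q => (amp q.1 * v q.1 q.2) ^ 2) (fun t => assemble n amp v t ^ 2) ?_ ?_,
    Fintype.sum_prod_type]
  · refine Finset.sum_congr rfl fun j _ => ?_
    rw [EuclideanSpace.real_norm_sq_eq, Finset.mul_sum]
    exact Finset.sum_congr rfl fun b _ => by ring
  · intro t ht
    have : ¬ (t : ℕ) < I * l := fun hlt => ht (exists_blockIndex_eq h hlt)
    simp [assemble, this]
  · intro q
    rw [assemble_blockIndex]

lemma sum_sq_blockVec_le (h : I * l ≤ n) {amp : Fin I → ℝ} (hamp : ∀ j, amp j ≠ 0)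
    (s : Fin n → ℝ) : ∑ j, amp j ^ 2 * ‖blockVec h amp s j‖ ^ 2 ≤ ∑ t, s t ^ 2 := by
  have h1 : ∑ j, amp j ^ 2 * ‖blockVec h amp s j‖ ^ 2 =
      ∑ q : Fin I × Fin l, s (blockIndex h q) ^ 2 := by
    rw [Fintype.sum_prod_type]
    refine Finset.sum_congr rfl fun j _ => ?_
    rw [EuclideanSpace.real_norm_sq_eq, Finset.mul_sum]
    refine Finset.sum_congr rfl fun b _ => ?_
    simp only [blockVec]
    have := hamp j
    field_simp
  rw [h1, ← Finset.sum_image (f := fun t => s t ^ 2) (blockIndex_injective h).injOn]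
  exact Finset.sum_le_sum_of_subset_of_nonneg (Finset.subset_univ _) fun t _ _ => sq_nonneg _

lemma measurable_blockVec (h : I * l ≤ n) (amp : Fin I → ℝ) (j : Fin I) :
    Measurable fun y : Fin n → ℝ => blockVec h amp y j := by
  unfold blockVec
  refine (WithLp.measurable_toLp 2 _).comp ?_
  fun_prop

lemma blockIndex_lt (h : I * l ≤ n) {i : ℕ} {j : Fin I} (hj : (j : ℕ) < i) (b : Fin l) :
    (blockIndex h (j, b) : ℕ) < i * l := by
  rw [blockIndex_val]
  have h1 : ((j : ℕ) + 1) * l ≤ i * l := Nat.mul_le_mul_right l hj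
  have h2 := b.2
  nlinarith

lemma assemble_congr (h : I * l ≤ n) (amp : Fin I → ℝ) {v v' : Fin I → EuclideanSpace ℝ (Fin l)}
    {i : ℕ} (hv : ∀ j : Fin I, (j : ℕ) < i → v j = v' j) {t : Fin n} (ht : (t : ℕ) < i * l) :
    assemble n amp v t = assemble n amp v' t := by
  by_cases htI : (t : ℕ) < I * l
  · obtain ⟨⟨j, b⟩, rfl⟩ := exists_blockIndex_eq h htI
    rw [assemble_blockIndex, assemble_blockIndex]
    rw [blockIndex_val] at ht
    have hj : (j : ℕ) < i := by
      by_contra! hcon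
      have := Nat.mul_le_mul_left l hcon
      nlinarith
    rw [hv j hj]
  · simp [assemble, htI]

end Blocks

/-! ### Causality -/

section Causality

variable {n : ℕ} {P N : ℝ}

/-- The sequence `s` with all entries from position `m` on set to zero. -/
noncomputable def truncateFrom (m : ℕ) (s : Fin n → ℝ) : Fin n → ℝ :=
  fun t => if (t : ℕ) < m then s t else 0

lemma measurable_truncateFrom (m : ℕ) :
    Measurable (truncateFrom m : (Fin n → ℝ) → (Fin n → ℝ)) := by
  refine measurable_pi_lambda _ fun t => ?_
  unfold truncateFrom
  split_ifs <;> fun_prop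

/-- A causal adversary treats sequences with a common prefix alike along this prefix. -/
lemma CausalAdversary.map_truncateFrom_eq (A : CausalAdversary n P N) {x x' : Fin n → ℝ}
    (hx : x ∈ energyBall n P) (hx' : x' ∈ energyBall n P) (m : ℕ)
    (h : ∀ t : Fin n, (t : ℕ) < m → x t = x' t) :
    (A.noise x).map (truncateFrom m) = (A.noise x').map (truncateFrom m) := by
  have := A.noise_markov
  induction m with
  | zero =>
    have h0 : (truncateFrom 0 : (Fin n → ℝ) → (Fin n → ℝ)) = fun _ => 0 := by
      ext s t; simp [truncateFrom]
    rw [h0, Measure.map_const, Measure.map_const, measure_univ, measure_univ]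
  | succ m ih =>
    have ih' := ih fun t ht => h t (by omega)
    by_cases hm : m < n
    swap
    · have h1 : (truncateFrom (m + 1) : (Fin n → ℝ) → (Fin n → ℝ)) = truncateFrom m := by
        ext s t
        have h2 : (t : ℕ) < m := by omega
        have h3 : (t : ℕ) < m + 1 := by omega
        simp [truncateFrom, h2, h3]
      rw [h1, ih']
    set t : Fin n := ⟨m, hm⟩ with ht
    obtain ⟨κ, hκ, hcaus⟩ := A.causal t
    have hbm : Measurable (before t) := by
      unfold before; fun_prop
    -- The noise before `t` is a function of the truncation at `m`, whose laws agree by induction.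
    -- The causal kernel then gives equal joint laws with `s t`, and the truncation at `m + 1` is a
    -- function of that pair.
    have hb : before t = before t ∘ truncateFrom m := by
      ext s u
      have : ((u : Fin n) : ℕ) < m := u.2
      simp [before, truncateFrom, this]
    have hbefore : (A.noise x).map (before t) = (A.noise x').map (before t) := by
      rw [hb, ← Measure.map_map hbm (measurable_truncateFrom m), ih',
        Measure.map_map hbm (measurable_truncateFrom m)]
    have hup : upTo t x = upTo t x' := by
      ext u
      have h1 : ((u : Fin n) : ℕ) ≤ m := u.2
      exact h u (by omega)
    have hpair := hcaus x hx
    rw [hbefore, hup, ← hcaus x' hx'] at hpair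
    let g : (Set.Iio t → ℝ) × ℝ → (Fin n → ℝ) := fun q u =>
      if hu : u < t then q.1 ⟨u, hu⟩ else if u = t then q.2 else 0
    have hg : Measurable g := by
      refine measurable_pi_lambda _ fun u => ?_
      simp only [g]
      split_ifs <;> fun_prop
    have hcomp : truncateFrom (m + 1) = g ∘ fun s : Fin n → ℝ => (before t s, s t) := by
      ext s u
      simp only [truncateFrom, g, Function.comp_apply, before]
      rcases lt_trichotomy u t with hu | hu | hu
      · have : (u : ℕ) < m + 1 := by have h1 : (u : ℕ) < m := hu; omega
        simp [hu, this]
      · subst hu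
        simp [ht]
      · have h1 : ¬ (u : ℕ) < m + 1 := by have h1 : m < (u : ℕ) := hu; omega
        simp [h1, hu.not_gt, hu.ne']
    have hpm : Measurable fun s : Fin n → ℝ => (before t s, s t) :=
      hbm.prodMk (measurable_pi_apply t)
    rw [hcomp, ← Measure.map_map hg hpm, hpair, Measure.map_map hg hpm]

lemma CausalAdversary.noise_apply_eq (A : CausalAdversary n P N) {x x' : Fin n → ℝ}
    (hx : x ∈ energyBall n P) (hx' : x' ∈ energyBall n P) (m : ℕ)
    (h : ∀ t : Fin n, (t : ℕ) < m → x t = x' t) {s : Set (Fin n → ℝ)} (hs : MeasurableSet s)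
    (hsm : truncateFrom m ⁻¹' s = s) : A.noise x s = A.noise x' s := by
  rw [← hsm, ← Measure.map_apply (measurable_truncateFrom m) hs,
    ← Measure.map_apply (measurable_truncateFrom m) hs, A.map_truncateFrom_eq hx hx' m h]

end Causality

/-! ### The probability of error of the random key code -/

section ErrorProbability

/-- The sum over the key of block `j` is at most `C`, and `G ^ (I - 1)` choices of the other keys
remain. Multiplying by `G` avoids the subtraction in the exponent. -/
lemma mul_sum_le_of_sum_update_le {I G : ℕ} {f : (Fin I → Fin G) → ℝ≥0∞} (j : Fin I) {C : ℝ≥0∞}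
    (h : ∀ κ, ∑ a, f (Function.update κ j a) ≤ C) : G * ∑ κ, f κ ≤ G ^ I * C := by
  classical
  rcases Nat.eq_zero_or_pos G with rfl | hG
  · simp
  let e := Equiv.funSplitAt j (Fin G)
  have h1 : ∑ κ, f κ = ∑ r : {i // i ≠ j} → Fin G, ∑ a, f (e.symm (a, r)) := by
    rw [← Equiv.sum_comp e.symm, Fintype.sum_prod_type, Finset.sum_comm]
  have h2 : ∀ r : {i // i ≠ j} → Fin G, ∑ a, f (e.symm (a, r)) ≤ C := by
    intro r
    refine le_trans (le_of_eq ?_) (h (e.symm (⟨0, hG⟩, r)))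
    refine Finset.sum_congr rfl fun a _ => ?_
    congr 1
    ext i
    by_cases hi : i = j
    · subst hi; simp [e, Equiv.funSplitAt, Equiv.piSplitAt]
    · simp [e, Equiv.funSplitAt, Equiv.piSplitAt, hi]
  have h3 : (G : ℝ≥0∞) * (Fintype.card ({i // i ≠ j} → Fin G) : ℕ) = G ^ I := by
    have := Fintype.card_congr e
    simp only [Fintype.card_prod, Fintype.card_fun, Fintype.card_fin] at this
    rw [Fintype.card_fun, Fintype.card_fin]
    exact_mod_cast this.symm
  calc (G : ℝ≥0∞) * ∑ κ, f κ ≤ G * ∑ _r : {i // i ≠ j} → Fin G, C := by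
        rw [h1]; gcongr with r; exact h2 r
    _ = G ^ I * C := by rw [Finset.sum_const, Finset.card_univ, nsmul_eq_mul, ← mul_assoc, h3]

/-- Events that never occur together more than `T` at a time have total probability at most `T`. -/
lemma sum_measure_le_of_ncard_le {Ω ι : Type*} [MeasurableSpace Ω] [Fintype ι] (μ : Measure Ω)
    [IsProbabilityMeasure μ] {s : ι → Set Ω} (hs : ∀ a, MeasurableSet (s a)) {T : ℕ}
    (hT : ∀ ω, {a | ω ∈ s a}.ncard ≤ T) : ∑ a, μ (s a) ≤ T := by
  classical
  calc ∑ a, μ (s a) = ∫⁻ ω, ∑ a, (s a).indicator 1 ω ∂μ := by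
        rw [lintegral_finsetSum _ fun a _ => measurable_one.indicator (hs a)]
        exact Finset.sum_congr rfl fun a _ => (lintegral_indicator_one (hs a)).symm
    _ ≤ ∫⁻ _, (T : ℝ≥0∞) ∂μ := by
        refine lintegral_mono fun ω => ?_
        have h1 : ∑ a, (s a).indicator (1 : Ω → ℝ≥0∞) ω = ({a | ω ∈ s a}.ncard : ℝ≥0∞) := by
          simp only [Set.indicator_apply, Pi.one_apply, Finset.sum_boole]
          rw [Set.ncard_eq_toFinset_card']
          congr 2
          ext a; simp
        simp only [h1]
        exact_mod_cast hT ω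
    _ = T := by simp

variable {M I G l n : ℕ}

/-- The messages that are listed after `i` blocks. -/
def listedMessages (δ Θ : ℝ) (Q : Fin M → Fin I → Fin G → ℕ) (i : ℕ) : Set (Fin M) :=
  {w | ∃ κ : Fin I → Fin G, Θ < prefixRate δ (fun j => Q w j (κ j)) i}

lemma listedMessages_congr (δ Θ : ℝ) {Q Q' : Fin M → Fin I → Fin G → ℕ} {i : ℕ}
    (h : ∀ w (j : Fin I) k, (j : ℕ) < i → Q w j k = Q' w j k) :
    listedMessages δ Θ Q i = listedMessages δ Θ Q' i := by
  ext w
  refine exists_congr fun κ => ?_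
  have : prefixRate δ (fun j => Q w j (κ j)) i = prefixRate δ (fun j => Q' w j (κ j)) i := by
    refine Finset.sum_congr rfl fun j hj => ?_
    simp only [h w j (κ j) (by simpa using hj)]
  rw [this]

/-- The noise indices of all codewords, as a function of the received sequence. -/
noncomputable def noiseTable (h : I * l ≤ n) (amp : Fin I → ℝ) (δ : ℝ)
    (z : Fin M → Fin I → Fin G → EuclideanSpace ℝ (Fin l)) (y : Fin n → ℝ) :
    Fin M → Fin I → Fin G → ℕ :=
  fun w j k => noiseIndex δ (blockVec h amp y j) (z w j k)

lemma measurable_noiseTable (h : I * l ≤ n) (amp : Fin I → ℝ) (δ : ℝ)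
    (z : Fin M → Fin I → Fin G → EuclideanSpace ℝ (Fin l)) :
    Measurable (noiseTable h amp δ z) := by
  refine measurable_pi_lambda _ fun w => measurable_pi_lambda _ fun j =>
    measurable_pi_lambda _ fun k => ?_
  have := measurable_blockVec h amp j
  unfold noiseTable noiseIndex
  exact Nat.measurable_floor.comp (by fun_prop)

/-- The keys of message `w` in block `j` whose codeword correlates with a codeword of `w'`. -/
def badKeys (τ : ℝ) (z : Fin M → Fin I → Fin G → EuclideanSpace ℝ (Fin l)) (w w' : Fin M)
    (j : Fin I) : Set (Fin G) :=
  {k | ∃ k', τ < inner ℝ (z w j k) (z w' j k')}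

lemma ncard_iUnion_badKeys_le {τ : ℝ} {z : Fin M → Fin I → Fin G → EuclideanSpace ℝ (Fin l)}
    {T : ℕ} {w : Fin M} {j : Fin I} (hz : ∀ w', w ≠ w' → (badKeys τ z w w' j).ncard ≤ T)
    {L : Set (Fin M)} (hL : L.ncard ≤ T) :
    {k | ∃ w' ∈ L, w ≠ w' ∧ k ∈ badKeys τ z w w' j}.ncard ≤ T * T := by
  classical
  have hsub : {k | ∃ w' ∈ L, w ≠ w' ∧ k ∈ badKeys τ z w w' j} ⊆
      ((L.toFinset.filter fun w' => w ≠ w').biUnion fun w' => (badKeys τ z w w' j).toFinset :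
        Finset (Fin G)) := by
    rintro k ⟨w', h1, h2, h3⟩
    simp only [Finset.coe_biUnion, Set.mem_iUnion, Finset.mem_coe, Set.mem_toFinset,
      Finset.mem_filter]
    exact ⟨w', ⟨h1, h2⟩, h3⟩
  refine (Set.ncard_le_ncard hsub (Set.toFinite _)).trans ?_
  rw [Set.ncard_coe_finset]
  refine (Finset.card_biUnion_le_card_mul _ _ T fun w' hw' => ?_).trans ?_
  · rw [← Set.ncard_eq_toFinset_card']
    exact hz w' (Finset.mem_filter.1 hw').2
  · refine Nat.mul_le_mul_right T ((Finset.card_filter_le _ _).trans ?_)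
    rwa [← Set.ncard_eq_toFinset_card']

/-- The transmitted sequence for a message and a sequence of keys. -/
noncomputable def codeword (n : ℕ) (amp : Fin I → ℝ)
    (z : Fin M → Fin I → Fin G → EuclideanSpace ℝ (Fin l)) (w : Fin M) (κ : Fin I → Fin G) :
    Fin n → ℝ :=
  assemble n amp fun j => z w j (κ j)

/-- The transmitter uses in block `j` a key that is bad with respect to a message listed after
`i` blocks. -/
def badEvent (h : I * l ≤ n) (amp : Fin I → ℝ) (δ Θ τ : ℝ)
    (z : Fin M → Fin I → Fin G → EuclideanSpace ℝ (Fin l)) (w : Fin M) (i : ℕ) (j : Fin I)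
    (x : Fin n → ℝ) (k : Fin G) : Set (Fin n → ℝ) :=
  {s | ∃ w' ∈ listedMessages δ Θ (noiseTable h amp δ z (x + s)) i, w ≠ w' ∧ k ∈ badKeys τ z w w' j}

lemma measurableSet_badEvent (h : I * l ≤ n) (amp : Fin I → ℝ) (δ Θ τ : ℝ)
    (z : Fin M → Fin I → Fin G → EuclideanSpace ℝ (Fin l)) (w : Fin M) (i : ℕ) (j : Fin I)
    (x : Fin n → ℝ) (k : Fin G) : MeasurableSet (badEvent h amp δ Θ τ z w i j x k) := by
  have h1 : Measurable fun s : Fin n → ℝ => noiseTable h amp δ z (x + s) :=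
    (measurable_noiseTable h amp δ z).comp (by fun_prop)
  exact h1 (MeasurableSet.of_discrete
    (s := {Q | ∃ w' ∈ listedMessages δ Θ Q i, w ≠ w' ∧ k ∈ badKeys τ z w w' j}))

/-- The list after `i` blocks is determined by the first `i * l` received symbols. -/
lemma badEvent_congr (h : I * l ≤ n) (amp : Fin I → ℝ) (δ Θ τ : ℝ)
    (z : Fin M → Fin I → Fin G → EuclideanSpace ℝ (Fin l)) (w : Fin M) {i : ℕ} (j : Fin I)
    {x x' s s' : Fin n → ℝ} (k : Fin G)
    (hx : ∀ t : Fin n, (t : ℕ) < i * l → x t + s t = x' t + s' t) :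
    s ∈ badEvent h amp δ Θ τ z w i j x k ↔ s' ∈ badEvent h amp δ Θ τ z w i j x' k := by
  have : listedMessages δ Θ (noiseTable h amp δ z (x + s)) i =
      listedMessages δ Θ (noiseTable h amp δ z (x' + s')) i := by
    refine listedMessages_congr δ Θ fun w j k hj => ?_
    have hb : blockVec h amp (x + s) j = blockVec h amp (x' + s') j := by
      unfold blockVec
      congr 1
      funext b
      rw [Pi.add_apply, Pi.add_apply, hx _ (blockIndex_lt h hj b)]
    rw [noiseTable, noiseTable, hb]
  simp only [badEvent, Set.mem_ofPred_eq, this]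

/-- Since a causal adversary does not know the keys of later blocks, the bad events are rare. -/
lemma mul_sum_badEvent_le {P N : ℝ} (h : I * l ≤ n) (amp : Fin I → ℝ) (δ Θ τ : ℝ)
    {z : Fin M → Fin I → Fin G → EuclideanSpace ℝ (Fin l)} {T : ℕ} {w : Fin M}
    (hx : ∀ κ, codeword n amp z w κ ∈ energyBall n P)
    (hbad : ∀ j w', w ≠ w' → (badKeys τ z w w' j).ncard ≤ T)
    (hlist : ∀ y i, (listedMessages δ Θ (noiseTable h amp δ z y) i).ncard ≤ T)
    (A : CausalAdversary n P N) {i : ℕ} {j : Fin I} (hij : i ≤ j) :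
    (G : ℝ≥0∞) * ∑ κ, A.noise (codeword n amp z w κ)
      (badEvent h amp δ Θ τ z w i j (codeword n amp z w κ) (κ j)) ≤ G ^ I * (T * T : ℕ) := by
  have := A.noise_markov
  refine mul_sum_le_of_sum_update_le j fun κ => ?_
  set x := codeword n amp z w κ with hxdef
  -- Changing the key of block `j ≥ i` leaves the first `i` blocks as they are, so the law of the
  -- noise there, and with it the law of the list, does not change. For a fixed list at most `T * T`
  -- keys are bad.
  have hagree : ∀ a (t : Fin n), (t : ℕ) < i * l →
      codeword n amp z w (Function.update κ j a) t = x t := by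
    intro a t ht
    refine assemble_congr h amp (fun j' hj' => ?_) ht
    have hne : j' ≠ j := by rintro rfl; omega
    simp only [Function.update_of_ne hne]
  have hterm : ∀ a, A.noise (codeword n amp z w (Function.update κ j a))
      (badEvent h amp δ Θ τ z w i j (codeword n amp z w (Function.update κ j a))
        (Function.update κ j a j)) = A.noise x (badEvent h amp δ Θ τ z w i j x a) := by
    intro a
    rw [Function.update_self]
    have hset : badEvent h amp δ Θ τ z w i j (codeword n amp z w (Function.update κ j a)) a =
        badEvent h amp δ Θ τ z w i j x a := by
      ext s
      exact badEvent_congr h amp δ Θ τ z w j a fun t ht => by rw [hagree a t ht]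
    rw [hset]
    refine A.noise_apply_eq (hx _) (hx _) (i * l) (hagree a)
      (measurableSet_badEvent h amp δ Θ τ z w i j x a) ?_
    ext s
    rw [Set.mem_preimage]
    exact badEvent_congr h amp δ Θ τ z w j a fun t ht => by simp [truncateFrom, ht]
  simp only [hterm]
  exact sum_measure_le_of_ncard_le _ (fun a => measurableSet_badEvent h amp δ Θ τ z w i j x a)
    fun s => ncard_iUnion_badKeys_le (hbad j) (hlist (x + s) i)

end ErrorProbability

/-! ### The random key code and the bound on its error. -/

section Code

variable {M I G l n : ℕ} {P N : ℝ}

/-- The code that sends codewords with independent uniform keys in all blocks. -/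
noncomputable def randomKeyCode (hG : 0 < G) (x : Fin M → (Fin I → Fin G) → Fin n → ℝ)
    (hx : ∀ w κ, x w κ ∈ energyBall n P) {dec : (Fin n → ℝ) → Fin M} (hdec : Measurable dec) :
    StochasticCode M n P where
  encoder w := ((G : ℝ≥0∞) ^ I)⁻¹ • ∑ κ, Measure.dirac (x w κ)
  encoder_prob w := by
    refine ⟨?_⟩
    have hG' : ((G : ℝ≥0∞) ^ I) ≠ 0 := pow_ne_zero _ (by exact_mod_cast hG.ne')
    simp only [Measure.smul_apply, Measure.finsetSum_apply, measure_univ, Finset.sum_const,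
      Finset.card_univ, Fintype.card_fun, Fintype.card_fin, smul_eq_mul, nsmul_eq_mul, mul_one]
    push_cast
    exact ENNReal.inv_mul_cancel hG' (by finiteness)
  encoder_power w := by
    have h0 : ∀ κ, Measure.dirac (x w κ) (energyBall n P)ᶜ = 0 := fun κ => by
      rw [Measure.dirac_apply]
      simp [hx w κ]
    rw [ae_iff]
    change (((G : ℝ≥0∞) ^ I)⁻¹ • ∑ κ, Measure.dirac (x w κ)) (energyBall n P)ᶜ = 0
    simp only [Measure.smul_apply, Measure.finsetSum_apply, h0, Finset.sum_const_zero, smul_zero]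
  decoder := Kernel.deterministic dec hdec
  decoder_markov := inferInstance

lemma errorProb_randomKeyCode (hG : 0 < G) (x : Fin M → (Fin I → Fin G) → Fin n → ℝ)
    (hx : ∀ w κ, x w κ ∈ energyBall n P) {dec : (Fin n → ℝ) → Fin M} (hdec : Measurable dec)
    (A : CausalAdversary n P N) (w : Fin M) :
    errorProb (randomKeyCode hG x hx hdec) A w =
      ((G : ℝ≥0∞) ^ I)⁻¹ * ∑ κ, A.noise (x w κ) {s | dec (x w κ + s) ≠ w} := by
  have h1 : ∀ κ, ∫⁻ s, (Kernel.deterministic dec hdec) (x w κ + s) {w}ᶜ ∂(A.noise (x w κ)) =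
      A.noise (x w κ) {s | dec (x w κ + s) ≠ w} := by
    intro κ
    have hmeas : MeasurableSet {s | dec (x w κ + s) ≠ w} :=
      (hdec.comp (measurable_const.add measurable_id)) (MeasurableSet.of_discrete (s := {w}ᶜ))
    rw [← lintegral_indicator_one hmeas]
    refine lintegral_congr fun s => ?_
    rw [Kernel.deterministic_apply' hdec _ MeasurableSet.of_discrete]
    rfl
  simp only [errorProb, randomKeyCode, lintegral_smul_measure, lintegral_finsetSum_measure,
    lintegral_dirac, h1, smul_eq_mul]

/-- A union bound over the `I * I` pairs of a list time and a later block. Energies are measured per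
`l`, hence the budget `n * N / l`: the adversary may spend everything on the blocks, including the
share of the at most `n - I * l` unused positions. -/
theorem exists_code {δ Θ σ τ slack : ℝ} {pw : Fin I → ℝ} {T : ℕ} (h : I * l ≤ n) (hl : 0 < l)
    (w₀ : Fin M) (hG : 0 < G) (hP : 0 ≤ P) (hpw : ∀ j, 0 < pw j) (hpws : ∑ j, pw j ≤ I * P)
    (hnp : NotPushable δ Θ pw (n * N / l) slack) (hδ : 0 < δ) (hΘ : 0 ≤ Θ)
    (hσ0 : 0 ≤ σ) (hσ : ∀ j, pw j ≤ σ) (hτ0 : 0 ≤ τ) (hτ1 : τ ≤ 1)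
    (hslack : (3 * τ + 2 * δ) * ∑ j, pw j + σ ≤ slack)
    {z : Fin M → Fin I → Fin G → EuclideanSpace ℝ (Fin l)}
    (hz : ∀ w j k, 1 - τ ≤ ‖z w j k‖ ∧ ‖z w j k‖ ≤ 1)
    (hbad : ∀ w w', w ≠ w' → ∀ j, {k | ∃ k', τ < inner ℝ (z w j k) (z w' j k')}.ncard ≤ T)
    (hlist : ∀ (y : Fin I → EuclideanSpace ℝ (Fin l)) (i : ℕ),
      {w | ∃ κ : Fin I → Fin G,
        Θ < prefixRate δ (fun j => noiseIndex δ (y j) (z w j (κ j))) i}.ncard ≤ T) :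
    ∃ c : StochasticCode M n P, maxErrorProb N c ≤ (I * I * (T * T) : ℕ) / (G : ℝ≥0∞) := by
  have hl' : (0 : ℝ) < l := by exact_mod_cast hl
  set amp : Fin I → ℝ := fun j => √(l * pw j) with hampdef
  have hamp2 : ∀ j, amp j ^ 2 = l * pw j := fun j =>
    Real.sq_sqrt (mul_nonneg hl'.le (hpw j).le)
  have hamp : ∀ j, amp j ≠ 0 := fun j => (Real.sqrt_pos.2 (mul_pos hl' (hpw j))).ne'
  have hx : ∀ w κ, codeword n amp z w κ ∈ energyBall n P := by
    intro w κ
    change ∑ t, assemble n amp (fun j => z w j (κ j)) t ^ 2 ≤ n * P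
    rw [sum_sq_assemble h]
    calc ∑ j, amp j ^ 2 * ‖z w j (κ j)‖ ^ 2 ≤ ∑ j, l * pw j := by
          refine Finset.sum_le_sum fun j _ => ?_
          rw [hamp2]
          exact mul_le_of_le_one_right (mul_nonneg hl'.le (hpw j).le)
            (pow_le_one₀ (norm_nonneg _) (hz w j (κ j)).2)
      _ ≤ l * (I * P) := by rw [← Finset.mul_sum]; gcongr
      _ = ((I * l : ℕ) : ℝ) * P := by push_cast; ring
      _ ≤ n * P := by gcongr
  set dec : (Fin n → ℝ) → Fin M := fun y =>
    decode δ Θ pw (n * N / l) w₀ (noiseTable h amp δ z y) with hdecdef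
  have hdec : Measurable dec :=
    (Measurable.of_discrete (f := decode δ Θ pw (n * N / l) w₀)).comp
      (measurable_noiseTable h amp δ z)
  refine ⟨randomKeyCode hG (codeword n amp z) hx hdec, iSup_le fun w => iSup_le fun A => ?_⟩
  rw [errorProb_randomKeyCode]
  have hcorrect : ∀ κ, A.noise (codeword n amp z w κ) {s | dec (codeword n amp z w κ + s) ≠ w} ≤
      ∑ q : Fin I × Fin I, if q.1 ≤ q.2 then A.noise (codeword n amp z w κ)
        (badEvent h amp δ Θ τ z w q.1 q.2 (codeword n amp z w κ) (κ q.2)) else 0 := by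
    intro κ
    set x := codeword n amp z w κ with hxdef
    have hsub : {s | dec (x + s) ≠ w} ≤ᵐ[A.noise x] ⋃ q ∈ Finset.univ.filter
        (fun q : Fin I × Fin I => q.1 ≤ q.2), badEvent h amp δ Θ τ z w q.1 q.2 x (κ q.2) := by
      filter_upwards [A.noise_power x (hx w κ)] with s hs hne
      by_contra hcon
      refine hne ?_
      have hcon' : ∀ i j : Fin I, i ≤ j → s ∉ badEvent h amp δ Θ τ z w i j x (κ j) := by
        intro i j hij hmem
        refine hcon (Set.mem_biUnion (x := (i, j)) ?_ hmem)
        simpa using hij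
      have hvec : ∀ j, blockVec h amp (x + s) j - z w j (κ j) = blockVec h amp s j := fun j => by
        rw [hxdef, codeword, blockVec_add_assemble h hamp, add_sub_cancel_left]
      refine decode_eq (y := blockVec h amp (x + s)) (κ := κ) hnp hδ hΘ (fun j => (hpw j).le)
        hσ0 hσ hτ0 hτ1 hslack (fun w j k => (hz w j k).1) w₀ ?_ ?_
      -- Noise indices are rounded down, so the true hypothesis is always admissible.
      · change ∑ j, pw j * (δ * noiseIndex δ (blockVec h amp (x + s) j) (z w j (κ j))) ≤ n * N / l
        rw [le_div_iff₀ hl']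
        calc (∑ j, pw j * (δ * noiseIndex δ (blockVec h amp (x + s) j) (z w j (κ j)))) * l
            ≤ ∑ j, amp j ^ 2 * ‖blockVec h amp s j‖ ^ 2 := by
              rw [Finset.sum_mul]
              refine Finset.sum_le_sum fun j _ => ?_
              have h1 := noiseIndex_mul_le hδ (blockVec h amp (x + s) j) (z w j (κ j))
              rw [hvec] at h1
              have h2 := mul_le_mul_of_nonneg_left h1 (mul_nonneg hl'.le (hpw j).le)
              rw [hamp2]
              linarith
          _ ≤ ∑ t, s t ^ 2 := sum_sq_blockVec_le h hamp s
          _ ≤ n * N := hs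
      · intro i j hij w' hw' hL k'
        by_contra! hk
        exact hcon' ⟨i, hij.trans_lt j.2⟩ j hij ⟨w', hL, hw', k', hk⟩
    refine (measure_mono_ae hsub).trans ((measure_biUnion_finset_le _ _).trans ?_)
    rw [Finset.sum_filter]
  have hG0 : (G : ℝ≥0∞) ≠ 0 := by exact_mod_cast hG.ne'
  have hGI : ((G : ℝ≥0∞) ^ I) ≠ 0 := pow_ne_zero _ hG0
  rw [ENNReal.le_div_iff_mul_le (Or.inl hG0) (Or.inl (by finiteness)), mul_assoc,
    mul_comm _ (G : ℝ≥0∞),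
    ENNReal.inv_mul_le_iff hGI (by finiteness)]
  calc (G : ℝ≥0∞) * ∑ κ, A.noise (codeword n amp z w κ) {s | dec (codeword n amp z w κ + s) ≠ w}
      ≤ G * ∑ κ, ∑ q : Fin I × Fin I, (if q.1 ≤ q.2 then A.noise (codeword n amp z w κ)
        (badEvent h amp δ Θ τ z w q.1 q.2 (codeword n amp z w κ) (κ q.2)) else 0) := by
        gcongr with κ
        exact hcorrect κ
    _ = ∑ q : Fin I × Fin I, G * ∑ κ, (if q.1 ≤ q.2 then A.noise (codeword n amp z w κ)
        (badEvent h amp δ Θ τ z w q.1 q.2 (codeword n amp z w κ) (κ q.2)) else 0) := by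
        rw [Finset.sum_comm, Finset.mul_sum]
    _ ≤ ∑ _q : Fin I × Fin I, (G : ℝ≥0∞) ^ I * (T * T : ℕ) := by
        refine Finset.sum_le_sum fun q _ => ?_
        by_cases hq : q.1 ≤ q.2
        · simp only [hq, if_true]
          exact mul_sum_badEvent_le h amp δ Θ τ (hx w) (fun j w' hw' => hbad w w' hw' j)
            (fun y i => hlist _ i) A hq
        · simp [hq]
    _ = _ := by
        simp only [Finset.sum_const, Finset.card_univ, Fintype.card_prod, Fintype.card_fin,
          nsmul_eq_mul]
        push_cast
        ring

/-- With a single message there is a code that never errs. -/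
lemma exists_trivial_code (hM : M = 1) (hP : 0 ≤ P) :
    ∃ c : StochasticCode M n P, maxErrorProb N c = 0 := by
  subst hM
  have hx : ∀ (w : Fin 1) (κ : Fin 0 → Fin 1), (fun _ _ => 0 : (Fin 0 → Fin 1) → Fin n → ℝ) κ ∈
      energyBall n P := fun _ _ => by
    simp only [energyBall, Set.mem_ofPred_eq]
    simpa using by positivity
  refine ⟨randomKeyCode one_pos (fun _ _ _ => 0) hx (dec := fun _ => 0) measurable_const, ?_⟩
  refine le_antisymm (iSup_le fun w => iSup_le fun A => ?_) bot_le
  rw [errorProb_randomKeyCode]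
  have hw : w = 0 := Subsingleton.elim _ _
  subst hw
  simp

end Code

/-! ### Achievability -/

section Achievability

/-- A pushable prefix with information at most `Θ` would give an attack on the optimization below
its lower bound `c`. The margin `δL` absorbs the rounding of noise levels, the excess of `B` over `K
* J * N`, and the slack. -/
lemma notPushable_of_le_objective {K J : ℕ} (hK : 0 < K) (hJ : 0 < J) {P N c η δL δ Θ B : ℝ}
    {p : Fin K → ℝ} (hp : p ∈ signalPowerSet K P)
    (hc : ∀ a ∈ feasibleAttacks K P N p, c ≤ objective K p a) (hη0 : 0 < η) (hη : η ≤ 1 / 2)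
    (hδN : δL ≤ η * N) (hδ0 : 0 < δL) (hδp : ∀ k, 2 * K * δL ≤ p k) (hδ : 0 < δ)
    (hδP : δ * P ≤ δL / 8) (hB : B ≤ K * J * (N + δL / 8))
    (hΘ : Θ < 2 * (K * J) * Real.log 2 * (c - 1 / 2 * -Real.logb 2 (1 - η) - 2 / K)) :
    NotPushable δ Θ (fun j : Fin (K * J) => p j.divNat) B (K * J * δL / 2) := by
  intro q hq i hrate
  by_contra! hcon
  have hK' : (0 : ℝ) < K := by positivity
  have hJ' : (0 : ℝ) < J := by positivity
  have hlog : 0 < Real.log 2 := Real.log_pos (by norm_num)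
  have hpw : ∀ j : Fin (K * J), 0 ≤ p j.divNat := fun j => (hp.1 _).le
  have hW : ∑ j : Fin (K * J), p j.divNat = K * J * P := by
    rw [← Equiv.sum_comp finProdFinEquiv, Fintype.sum_prod_type]
    have hdiv : ∀ (k : Fin K) (b : Fin J), (finProdFinEquiv (k, b)).divNat = k := fun k b =>
      congrArg Prod.fst (finProdFinEquiv.symm_apply_apply (k, b))
    simp only [hdiv]
    simp only [Finset.sum_const, Finset.card_univ, Fintype.card_fin, nsmul_eq_mul,
      ← Finset.mul_sum, hp.2]
    ring
  set u : Fin (K * J) → ℝ := fun j => noiseLevel δ (q j) with hu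
  have hAu : ∑ j : Fin (K * J), (if (j : ℕ) < i then p j.divNat * u j else 0) ≤
      prefixSum i (fun j : Fin (K * J) => p j.divNat * (δ * q j)) + K * J * (δL / 8) := by
    have h1 : ∑ j : Fin (K * J), (if (j : ℕ) < i then p j.divNat * u j else 0) ≤
        ∑ j : Fin (K * J), ((if (j : ℕ) < i then p j.divNat * (δ * q j) else 0) +
          δ * p j.divNat) := by
      refine Finset.sum_le_sum fun j _ => ?_
      have h2 := mul_le_mul_of_nonneg_left (noiseLevel_le δ (q j)) (hpw j)
      have h3 := mul_nonneg hδ.le (hpw j)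
      split_ifs <;> linarith
    rw [Finset.sum_add_distrib, ← Finset.mul_sum, hW] at h1
    have h4 : δ * (K * J * P) ≤ K * J * (δL / 8) := by
      have := mul_le_mul_of_nonneg_left hδP (by positivity : (0 : ℝ) ≤ K * J)
      linarith
    rw [prefixSum, Finset.sum_filter]
    exact h1.trans (add_le_add le_rfl h4)
  have hAq : prefixSum i (fun j : Fin (K * J) => p j.divNat * (δ * q j)) ≤ B :=
    (Finset.sum_le_sum_of_subset_of_nonneg (Finset.filter_subset _ _)
      fun j _ _ => mul_nonneg (hpw j) (by positivity)).trans hq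
  have hSq : ∑ j : Fin (K * J), (if (j : ℕ) < i then 0 else p j.divNat) =
      suffixSum i (fun j : Fin (K * J) => p j.divNat) := by
    rw [suffixSum, Finset.sum_filter]
    exact Finset.sum_congr rfl fun j _ => by split_ifs <;> simp_all
  have hKJ : (0 : ℝ) < K * J := by positivity
  have hKJδ : 0 < (K * J : ℝ) * δL := by positivity
  have hfin := le_prefix_rate_of_pushable hJ hp hc hK hη0 hη hδN hδ0.le hδp (u := u) (i := i)
    (fun j => noiseLevel_pos hδ _) (fun j => noiseLevel_le_one δ _) (by nlinarith)
    (by rw [hSq]; nlinarith)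
  have hr : ∑ j : Fin (K * J), (if (j : ℕ) < i then -Real.logb 2 (u j) else 0) =
      prefixRate δ q i / Real.log 2 := by
    rw [prefixRate, Finset.sum_div, Finset.sum_filter]
    refine Finset.sum_congr rfl fun j _ => ?_
    split_ifs
    · rw [Real.logb, neg_div]
    · rfl
  rw [hr] at hfin
  have h5 : c - 1 / 2 * -Real.logb 2 (1 - η) - 2 / K ≤
      1 / (2 * (K * J)) * (prefixRate δ q i / Real.log 2) := by linarith
  have h6 : 1 / (2 * ((K : ℝ) * J)) * (prefixRate δ q i / Real.log 2) =
      prefixRate δ q i / (2 * (K * J) * Real.log 2) := by field_simp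
  rw [h6, le_div_iff₀ (by positivity)] at h5
  linarith

lemma exists_margin {ε : ℝ} (hε : 0 < ε) :
    ∃ η : ℝ, 0 < η ∧ η ≤ 1 / 2 ∧ 1 / 2 * -Real.logb 2 (1 - η) ≤ ε := by
  have h1 : (2 : ℝ) ^ (-(2 * ε)) < 1 :=
    Real.rpow_lt_one_of_one_lt_of_neg (by norm_num) (by linarith)
  refine ⟨min (1 / 2) (1 - 2 ^ (-(2 * ε))), lt_min (by norm_num) (by linarith), min_le_left _ _, ?_⟩
  have h2 : (2 : ℝ) ^ (-(2 * ε)) ≤ 1 - min (1 / 2) (1 - 2 ^ (-(2 * ε))) := by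
    linarith [min_le_right (1 / 2 : ℝ) (1 - 2 ^ (-(2 * ε)))]
  have h3 := Real.logb_le_logb_of_le (by norm_num : (1 : ℝ) < 2) (by positivity) h2
  rw [Real.logb_rpow (by norm_num) (by norm_num)] at h3
  linarith

lemma tendsto_nat_sqrt_atTop : Filter.Tendsto Nat.sqrt Filter.atTop Filter.atTop :=
  Filter.tendsto_atTop_atTop.2 fun b => ⟨b * b, fun _ h => Nat.le_sqrt.2 h⟩

lemma eventually_optimalValue_sqrt_le {P N ε : ℝ} (hP : 0 < P) (hN : 0 < N) (hε : 0 < ε) {K : ℕ}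
    (hK : 0 < K) :
    ∀ᶠ n : ℕ in Filter.atTop, optimalValue (Nat.sqrt n) P N ≤ optimalValue K P N + ε := by
  have hlim : Filter.Tendsto (fun m : ℕ => (1 + (K : ℝ) ^ 2 / m) * optimalValue K P N) Filter.atTop
      (nhds ((1 + 0) * optimalValue K P N)) :=
    ((tendsto_const_div_atTop_nhds_zero_nat _).const_add 1).mul_const _
  rw [add_zero, one_mul] at hlim
  have h := (hlim.eventually_lt_const (lt_add_of_pos_right _ hε)).and (Filter.eventually_ge_atTop K)
  filter_upwards [tendsto_nat_sqrt_atTop.eventually h] with n hn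
  exact (optimalValue_le_mul hK hn.2 hP hN).trans hn.1.le

/-- Half of the exponent `g / I` per symbol is given up to absorb the constant `D * exp g`, where
`exp g` accounts for the incomplete last block. -/
lemma div_le_exp_neg {g I l n G D : ℝ} (hg : 0 < g) (hI : 0 < I) (hn : n ≤ I * l + I)
    (hG : Real.exp (g * l) ≤ G) (hD : D * Real.exp g ≤ Real.exp (g / (2 * I) * n)) :
    D / G ≤ Real.exp (-(g / (2 * I) * n)) := by
  rw [div_le_iff₀ ((Real.exp_pos _).trans_le hG)]
  have h1 : Real.exp (g / (2 * I) * n) ≤ Real.exp (-(g / (2 * I) * n)) * (Real.exp g * G) := by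
    calc Real.exp (g / (2 * I) * n)
        ≤ Real.exp (-(g / (2 * I) * n) + (g + g * l)) := by
          refine Real.exp_le_exp.2 ?_
          have h2 : g / (2 * I) * n ≤ g / (2 * I) * (I * l + I) := by gcongr
          have h3 : g / (2 * I) * (I * l + I) = (g * l + g) / 2 := by field_simp
          linarith
      _ ≤ _ := by rw [Real.exp_add, Real.exp_add]; gcongr
  refine le_of_mul_le_mul_right ?_ (Real.exp_pos g)
  linarith

set_option maxHeartbeats 1000000 in
/-- Every rate below the limit of the optimal values is achievable with an exponentially small
maximal probability of error. -/
theorem exists_code_sqrt (P N : ℝ) (hP : 0 < P) (hN : 0 < N) {ε : ℝ} (hε : 0 < ε) :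
    ∃ c₂ : ℝ, 0 < c₂ ∧ ∀ᶠ n : ℕ in Filter.atTop,
      ∃ c : StochasticCode ⌈(2 : ℝ) ^ ((n : ℝ) * (optimalValue (Nat.sqrt n) P N - ε))⌉₊ n P,
        maxErrorProb N c ≤ ENNReal.ofReal (Real.exp (-(c₂ * n))) := by
  -- The budget: `ε / 4` for passing from length `Nat.sqrt n` to `K`, `ε / 8` for a nearly optimal
  -- allocation, `ε / 16` each for `η` and for `2 / K`. The threshold `Θ` sits at `C - ε / 2` and
  -- the rate at `R = C - 3 * ε / 4`, so both remaining inequalities are strict.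
  obtain ⟨K, hKε⟩ := exists_nat_ge (32 / ε)
  have hK' : (0 : ℝ) < K := (by positivity : 0 < 32 / ε).trans_le hKε
  have hK : 0 < K := by exact_mod_cast hK'
  have h2K : 2 / (K : ℝ) ≤ ε / 16 := by
    rw [div_le_iff₀ hε] at hKε
    rw [div_le_div_iff₀ hK' (by norm_num)]; linarith
  have hopt := eventually_optimalValue_sqrt_le hP hN (by linarith : 0 < ε / 4) hK
  set C := optimalValue K P N with hC
  set R := C - 3 * ε / 4 with hR
  -- If `R ≤ 0`, the number of messages rounds up to one.
  rcases le_or_gt R 0 with hR0 | hR0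
  · refine ⟨1, one_pos, ?_⟩
    filter_upwards [hopt] with n hn
    have hM : ⌈(2 : ℝ) ^ ((n : ℝ) * (optimalValue (Nat.sqrt n) P N - ε))⌉₊ = 1 := by
      have h1 : (2 : ℝ) ^ ((n : ℝ) * (optimalValue (Nat.sqrt n) P N - ε)) ≤ 1 :=
        Real.rpow_le_one_of_one_le_of_nonpos (by norm_num)
          (mul_nonpos_of_nonneg_of_nonpos n.cast_nonneg (by linarith))
      have h2 : 0 < (2 : ℝ) ^ ((n : ℝ) * (optimalValue (Nat.sqrt n) P N - ε)) := by positivity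
      refine le_antisymm (Nat.ceil_le.2 (by exact_mod_cast h1)) (Nat.ceil_pos.2 h2)
    obtain ⟨c, hc⟩ := exists_trivial_code (n := n) (N := N) hM hP.le
    exact ⟨c, hc ▸ bot_le⟩
  obtain ⟨η, hη0, hη, hηε⟩ := exists_margin (by linarith : 0 < ε / 16)
  obtain ⟨p, hp, hpC⟩ :=
    exists_signalPower_near_optimal (n := K) (N := N) hP (by linarith : 0 < ε / 8)
  have : Nonempty (Fin K) := ⟨⟨0, hK⟩⟩
  obtain ⟨k₀, hk₀⟩ := Finite.exists_min p
  have hpk₀ := hp.1 k₀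
  have hpmax : ∀ k, p k ≤ K * P := fun k => by
    rw [← hp.2]
    exact Finset.single_le_sum (fun k _ => (hp.1 k).le) (Finset.mem_univ k)
  set δL := min (η * N) (p k₀ / (2 * K)) with hδL
  have hδL0 : 0 < δL := by positivity
  have hδLp : ∀ k, 2 * K * δL ≤ p k := fun k => by
    have : δL ≤ p k₀ / (2 * K) := min_le_right _ _
    rw [le_div_iff₀ (by positivity)] at this
    linarith [hk₀ k]
  set δ := δL / (16 * P) with hδdef
  have hδ0 : 0 < δ := by positivity
  have hδP : δ * P = δL / 16 := by rw [hδdef]; field_simp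
  set τ := min (1 / 2) (δL / (24 * P)) with hτdef
  have hτ0 : 0 < τ := by positivity
  have hτ1 : τ < 1 := (min_le_left _ _).trans_lt (by norm_num)
  have hτP : τ * P ≤ δL / 24 := by
    have : τ ≤ δL / (24 * P) := min_le_right _ _
    rw [le_div_iff₀ (by positivity)] at this
    linarith
  -- The slack is `K * J * δL / 2`. The terms `3 * τ` and `2 * δ` take `δL / 8` each per block, and
  -- `J` is so large that a single block, of power at most `K * P`, takes no more than the other
  -- half.
  obtain ⟨J, hJδ⟩ := exists_nat_ge (4 * P / δL)
  have hJ' : (0 : ℝ) < J := (by positivity : 0 < 4 * P / δL).trans_le hJδ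
  have hJ : 0 < J := by exact_mod_cast hJ'
  rw [div_le_iff₀ hδL0] at hJδ
  set I := K * J with hI
  have hIpos : 0 < I := Nat.mul_pos hK hJ
  have hI' : (I : ℝ) = K * J := by rw [hI]; push_cast; ring
  have hIpos' : (0 : ℝ) < I := by exact_mod_cast hIpos
  have hlog : 0 < Real.log 2 := Real.log_pos (by norm_num)
  set ρ : ℝ := I * Real.log 2 * R with hρ
  have hρ0 : 0 < ρ := by positivity
  set Θ : ℝ := 2 * (K * J) * Real.log 2 * (C - ε / 2) with hΘ
  have hΘ2 : Θ / 2 = ρ + I * Real.log 2 * (ε / 4) := by rw [hΘ, hρ, hR, hI']; ring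
  have hρΘ : ρ < Θ / 2 := by
    rw [hΘ2]; exact lt_add_of_pos_right _ (by positivity)
  set pw : Fin I → ℝ := fun j => p (Fin.divNat (n := J) j) with hpwdef
  have hW : ∑ j, pw j = I * P := by
    rw [← Equiv.sum_comp finProdFinEquiv, Fintype.sum_prod_type]
    have hdiv : ∀ (k : Fin K) (b : Fin J), pw (finProdFinEquiv (k, b)) = p k := fun k b =>
      congrArg (fun q : Fin K × Fin J => p q.1) (finProdFinEquiv.symm_apply_apply (k, b))
    simp only [hdiv, Finset.sum_const, Finset.card_univ, Fintype.card_fin, nsmul_eq_mul,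
      ← Finset.mul_sum, hp.2]
    rw [hI']; ring
  obtain ⟨g, hg, T, hT⟩ := exists_codebook I (a := 2 * Real.exp ρ) (by positivity) hτ0 hτ1 hδ0 hρΘ
  have hdivlim : Filter.Tendsto (fun n : ℕ => n / I) Filter.atTop Filter.atTop :=
    Nat.tendsto_div_const_atTop hIpos.ne'
  have hlarge : ∀ᶠ n : ℕ in Filter.atTop,
      (I * I * (T * T) : ℕ) * Real.exp g ≤ Real.exp (g / (2 * I) * n) := by
    have : Filter.Tendsto (fun n : ℕ => Real.exp (g / (2 * I) * n)) Filter.atTop Filter.atTop :=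
      Real.tendsto_exp_atTop.comp
        (tendsto_natCast_atTop_atTop.const_mul_atTop (by positivity : 0 < g / (2 * I)))
    exact this.eventually_ge_atTop _
  -- For `l ≥ l₀` the unused positions raise the noise budget by at most `δL / 8` per block.
  obtain ⟨l₀, hl₀⟩ := exists_nat_ge (8 * N / δL)
  refine ⟨g / (2 * I), by positivity, ?_⟩
  filter_upwards [hopt, hdivlim.eventually hT, hlarge,
    hdivlim.eventually (Filter.eventually_ge_atTop (max 1 l₀))] with n hn hcb hnl hnl₀
  set l := n / I with hl
  have hl1 : 0 < l := lt_of_lt_of_le one_pos ((le_max_left _ _).trans hnl₀)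
  have hl' : (0 : ℝ) < l := by exact_mod_cast hl1
  have hlδ : 8 * N / δL ≤ l := hl₀.trans (by exact_mod_cast (le_max_right _ _).trans hnl₀)
  rw [div_le_iff₀ hδL0] at hlδ
  have hIl : I * l ≤ n := Nat.mul_div_le n I
  have hnI : (n : ℝ) ≤ I * l + I := by
    have := (Nat.lt_mul_div_succ n hIpos).le
    rw [← hl] at this
    have h2 : (n : ℝ) ≤ (I * (l + 1) : ℕ) := by exact_mod_cast this
    push_cast at h2
    linarith
  set M := ⌈(2 : ℝ) ^ ((n : ℝ) * (optimalValue (Nat.sqrt n) P N - ε))⌉₊ with hM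
  have hMpos : 0 < M := Nat.ceil_pos.2 (by positivity)
  have hMle : (M : ℝ) ≤ 2 * Real.exp ρ * Real.exp (ρ * l) := by
    have h1 : (2 : ℝ) ^ ((n : ℝ) * (optimalValue (Nat.sqrt n) P N - ε)) ≤ Real.exp (ρ + ρ * l) := by
      rw [Real.rpow_def_of_pos (by norm_num)]
      refine Real.exp_le_exp.2 ?_
      have h2 : (n : ℝ) * (optimalValue (Nat.sqrt n) P N - ε) ≤ n * R :=
        mul_le_mul_of_nonneg_left (by linarith) n.cast_nonneg
      have h3 : (n : ℝ) * R ≤ (I * l + I) * R := mul_le_mul_of_nonneg_right hnI hR0.le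
      have h4 := mul_le_mul_of_nonneg_left (h2.trans h3) hlog.le
      refine h4.trans (le_of_eq ?_)
      rw [hρ]; ring
    have h5 : 1 ≤ Real.exp (ρ + ρ * l) := Real.one_le_exp (by positivity)
    have h6 := (Nat.ceil_lt_add_one (a := (2 : ℝ) ^
      ((n : ℝ) * (optimalValue (Nat.sqrt n) P N - ε))) (by positivity)).le
    rw [← hM] at h6
    rw [Real.exp_add] at h1 h5
    linarith
  obtain ⟨G, hG, z, hz, hbad, hlist⟩ := hcb M hMle
  have hG' : (0 : ℝ) < G := (Real.exp_pos _).trans_le hG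
  have hGpos : 0 < G := by exact_mod_cast hG'
  have hB : (n : ℝ) * N / l ≤ K * J * (N + δL / 8) := by
    rw [div_le_iff₀ hl', ← hI']
    have h1 : (n : ℝ) * N ≤ (I * l + I) * N := mul_le_mul_of_nonneg_right hnI hN.le
    nlinarith
  have hnp : NotPushable δ Θ pw (n * N / l) (K * J * δL / 2) := by
    refine notPushable_of_le_objective hK hJ hp hpC hη0 hη (min_le_left _ _) hδL0 hδLp hδ0
      (by linarith) hB ?_
    rw [hΘ]
    refine mul_lt_mul_of_pos_left ?_ (by positivity)
    linarith
  obtain ⟨c, hc⟩ := exists_code (T := T) (σ := K * P) hIl hl1 (⟨0, hMpos⟩ : Fin M) hGpos hP.le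
    (fun j => hp.1 _) hW.le hnp hδ0 (by linarith) (by positivity) (fun j => hpmax _) hτ0.le hτ1.le
    (by
      rw [hW, hI']
      have h1 : (3 * τ + 2 * δ) * P ≤ δL / 4 := by linarith
      have h2 := mul_le_mul_of_nonneg_left h1 (by positivity : (0 : ℝ) ≤ K * J)
      have h3 := mul_le_mul_of_nonneg_left hJδ hK'.le
      linarith) hz hbad hlist
  refine ⟨c, hc.trans ?_⟩
  have hdiv : ((I * I * (T * T) : ℕ) : ℝ≥0∞) / (G : ℝ≥0∞) =
      ENNReal.ofReal ((I * I * (T * T) : ℕ) / (G : ℝ)) := by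
    rw [ENNReal.ofReal_div_of_pos hG', ENNReal.ofReal_natCast, ENNReal.ofReal_natCast]
  rw [hdiv]
  refine ENNReal.ofReal_le_ofReal ?_
  exact div_le_exp_neg hg hIpos' hnI hG hnl

end Achievability

end CausalQuadratic

theorem theorem2 (P N : ℝ) (hP : 0 < P) (hN : 0 < N) :
    ∃ c₁ : ℝ, 0 < c₁ ∧ ∀ ε : ℝ, 0 < ε →
      ∃ c₂ : ℝ, 0 < c₂ ∧ ∃ n₀ : ℕ, ∀ n : ℕ, n₀ ≤ n →
        ∃ c : CausalQuadratic.StochasticCode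
            ⌈(2 : ℝ) ^ ((n : ℝ) * (CausalQuadratic.optimalValue (Nat.sqrt n) P N - ε))⌉₊ n P,
          CausalQuadratic.maxErrorProb N c ≤
            ENNReal.ofReal
              (Real.exp (-(c₁ * (((n : ℝ) + Real.log ε) * Real.exp (Real.sqrt n) - n / ε)))
                + Real.exp (-(c₂ * n))) := by
  -- Any positive `c₁` works: the first exponential is only needed to be nonnegative.
  refine ⟨1, one_pos, fun ε hε => ?_⟩
  obtain ⟨c₂, hc₂, h⟩ := CausalQuadratic.exists_code_sqrt P N hP hN hε
  obtain ⟨n₀, hn₀⟩ := Filter.eventually_atTop.1 h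
  refine ⟨c₂, hc₂, n₀, fun n hn => ?_⟩
  obtain ⟨c, hc⟩ := hn₀ n hn
  exact ⟨c, hc.trans (ENNReal.ofReal_le_ofReal (le_add_of_nonneg_left (Real.exp_pos _).le))⟩
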